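/- Let $M=\mathbb H^3/\Gamma$ be a complete hyperbolic 3-manifold ($\Gamma$ acts freely and properly discontinuously by isometries on the upper half-space $\mathbb H^3=\{(x,y,z): z>0\}$) with covering map $\rho:\mathbb H^3\to M$. Let $N\subset M$ be a toroidal cusp: $N=\rho(B)$ for a horoball $B$ (the image of $\{z\ge 1\}$ under an isometry of $\mathbb H^3$) whose translates under $\Gamma$ have pairwise disjoint interiors, and the quotient $T=\partial N$ of the horosphere $\partial B$ by the stabilizer of $B$ in $\Gamma$ is a torus, mapped to $M$ by $\rho$. Let $S$ be a closed, connected, possibly nonorientable hyperbolic surface of genus $g$, where $g$ is normalized by $\chi(S)=2-2g$ (so $g$ is the usual genus if $S$ is orientable, and half the number of crosscaps if not), and let $F=(S,\varphi)$ be a pleated surface in $M$. That is, $\varphi:S\to M$ is continuous; it maps every geodesic segment of $S$ to an arc of the same length that is geodesic on the closure of each component of the complement of some closed nowhere dense subset of the arc; and every point of $S$ lies on an open geodesic segment that $\varphi$ maps to a geodesic segment of $M$. Suppose that $F$ is incompressible, i.e. $\varphi_*:\pi_1(S)\to\pi_1(M)$ is injective, and that $F$ is not coannular to $T$, i.e.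 there is no $\pi_1$-injective map of an annulus $S^1\times[0,1]\to M$ whose restriction to $S^1\times\{0\}$ is a loop on $F$ (the composition of $\varphi$ with a loop in $S$) and whose restriction to $S^1\times\{1\}$ is a loop on $T$. (An essential surface is in particular incompressible.) Let the depth $d_N(F)$ be the maximal distance in $M$ from points of $F\cap N$ to $T$, and $0$ if $F\cap N=\emptyset$. Then $$d_N(F)<\ln(2g\pi).$$ -/

import Mathlib

noncomputable section

open scoped UpperHalfPlane Pointwise ENNReal

/-! ### Hyperbolic three-space: the upper half-space model -/

/-- Points `(x, y, z)` of `ℝ³` with `z > 0`. -/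
@[ext]
structure HypSpace where
  x : ℝ
  y : ℝ
  z : ℝ
  z_pos : 0 < z

namespace HypSpace

/-- The underlying point of Euclidean three-space. -/
def toE (p : HypSpace) : EuclideanSpace ℝ (Fin 3) := !₂[p.x, p.y, p.z]

/-- The mirror image of a point in the plane `z = 0` (used for the triangle inequality). -/
def mirror (p : HypSpace) : EuclideanSpace ℝ (Fin 3) := !₂[p.x, p.y, -p.z]

theorem dist_toE (p q : HypSpace) :
    dist p.toE q.toE = √((p.x - q.x) ^ 2 + (p.y - q.y) ^ 2 + (p.z - q.z) ^ 2) := by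
  simp [toE, EuclideanSpace.dist_eq, Fin.sum_univ_three, Real.dist_eq, sq_abs]

theorem dist_toE_mirror (p q : HypSpace) :
    dist p.toE q.mirror = √((p.x - q.x) ^ 2 + (p.y - q.y) ^ 2 + (p.z + q.z) ^ 2) := by
  simp [toE, mirror, EuclideanSpace.dist_eq, Fin.sum_univ_three, Real.dist_eq, sq_abs]

/-- The distance of the Riemannian metric `(dx² + dy² + dz²) / z²`, by the same closed formula as
for Mathlib's upper half-plane: `sinh (d / 2) = |p - q| / (2 √(z_p z_q))`. -/
instance : Dist HypSpace :=
  ⟨fun p q => 2 * Real.arsinh (dist p.toE q.toE / (2 * √(p.z * q.z)))⟩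

theorem dist_eq (p q : HypSpace) :
    dist p q = 2 * Real.arsinh (dist p.toE q.toE / (2 * √(p.z * q.z))) := rfl

theorem sinh_half_dist (p q : HypSpace) :
    Real.sinh (dist p q / 2) = dist p.toE q.toE / (2 * √(p.z * q.z)) := by
  rw [dist_eq, mul_div_cancel_left₀ _ (two_ne_zero' ℝ), Real.sinh_arsinh]

theorem cosh_half_dist (p q : HypSpace) :
    Real.cosh (dist p q / 2) = dist p.toE q.mirror / (2 * √(p.z * q.z)) := by
  have hp := p.z_pos
  have hq := q.z_pos
  rw [← sq_eq_sq₀ (by positivity) (by positivity), Real.cosh_sq', sinh_half_dist, div_pow, div_pow,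
    mul_pow, Real.sq_sqrt (by positivity), dist_toE, dist_toE_mirror, Real.sq_sqrt (by positivity),
    Real.sq_sqrt (by positivity)]
  field_simp
  ring

theorem dist_triangle' (a b c : HypSpace) : dist a c ≤ dist a b + dist b c := by
  have ha := a.z_pos
  have hb := b.z_pos
  have hc := c.z_pos
  have key := EuclideanGeometry.mul_dist_le_mul_dist_add_mul_dist a.toE b.toE c.toE b.mirror
  have hbb : dist b.toE b.mirror = 2 * b.z := by
    rw [dist_toE_mirror, Real.sqrt_eq_iff_mul_self_eq (by positivity) (by positivity)]
    ring
  have hcomm : dist b.toE c.mirror = dist c.toE b.mirror := by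
    rw [dist_toE_mirror, dist_toE_mirror]
    congr 1
    ring
  suffices h : Real.sinh (dist a c / 2) ≤ Real.sinh (dist a b / 2 + dist b c / 2) by
    have := Real.sinh_le_sinh.1 h
    linarith
  rw [Real.sinh_add, sinh_half_dist, sinh_half_dist, sinh_half_dist, cosh_half_dist,
    cosh_half_dist, hcomm, Real.sqrt_mul ha.le, Real.sqrt_mul ha.le, Real.sqrt_mul hb.le]
  rw [hbb] at key
  have sa := Real.sqrt_pos.2 ha
  have sb := Real.sqrt_pos.2 hb
  have sc := Real.sqrt_pos.2 hc
  have hz : b.z = √b.z * √b.z := (Real.mul_self_sqrt hb.le).symm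
  have e : dist a.toE b.toE / (2 * (√a.z * √b.z)) * (dist c.toE b.mirror / (2 * (√b.z * √c.z))) +
      dist a.toE b.mirror / (2 * (√a.z * √b.z)) * (dist b.toE c.toE / (2 * (√b.z * √c.z))) =
      (dist a.toE b.toE * dist c.toE b.mirror + dist b.toE c.toE * dist a.toE b.mirror) /
        (2 * (√a.z * √c.z) * (2 * b.z)) := by
    rw [hz]
    simp only [Real.sqrt_mul_self sb.le]
    field_simp
  rw [e, div_le_div_iff₀ (by positivity) (by positivity)]
  have h := mul_le_mul_of_nonneg_right key (by positivity : 0 ≤ 2 * (√a.z * √c.z))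
  linarith

instance : MetricSpace HypSpace where
  dist_self p := by simp [dist_eq]
  dist_comm p q := by rw [dist_eq, dist_eq, dist_comm, mul_comm p.z]
  dist_triangle := dist_triangle'
  eq_of_dist_eq_zero {p q} h := by
    have hp := p.z_pos
    have hq := q.z_pos
    have h2 : √(p.z * q.z) ≠ 0 := (Real.sqrt_pos.2 (mul_pos hp hq)).ne'
    have h1 : dist p.toE q.toE = 0 := by simpa [dist_eq, h2] using h
    have h3 : p.toE = q.toE := dist_eq_zero.1 h1
    ext
    · simpa [toE] using congrFun (congrArg WithLp.ofLp h3) 0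
    · simpa [toE] using congrFun (congrArg WithLp.ofLp h3) 1
    · simpa [toE] using congrFun (congrArg WithLp.ofLp h3) 2

end HypSpace

/-! ### Complete hyperbolic manifolds

A complete hyperbolic surface (3-manifold) is the quotient of the hyperbolic plane `ℍ` (of the
hyperbolic space `HypSpace`) by a group acting freely and properly discontinuously by isometries;
orientation-reversing isometries are allowed. -/

/-- The orbit space `X / G`, with the quotient topology. -/
abbrev OrbitSpace (G X : Type*) [Group G] [MulAction G X] : Type _ :=
  Quotient (MulAction.orbitRel G X)

/-- The covering projection `X → X / G`. -/
def OrbitSpace.proj (G : Type*) {X : Type*} [Group G] [MulAction G X] (x : X) : OrbitSpace G X :=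
  Quotient.mk (MulAction.orbitRel G X) x

/-- The distance of the quotient metric: the least distance between points above `p` and `q`. -/
def OrbitSpace.qdist {G X : Type*} [Group G] [MulAction G X] [PseudoEMetricSpace X]
    (p q : OrbitSpace G X) : ℝ≥0∞ :=
  ⨅ (x : X) (_ : OrbitSpace.proj G x = p) (y : X) (_ : OrbitSpace.proj G y = q), edist x y

/-! ### Closed surfaces and their genus -/

/-- The point with parameter `t ∈ [0, 1]` on the `j`-th of `m` consecutive equal arcs ("edges"),
traversed counterclockwise, of the unit circle. -/
def polygonEdge (m j : ℕ) (t : ℝ) : ℂ :=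
  Complex.exp (2 * Real.pi * Complex.I * ((j + t) / m))

/-- The edges of a `4n`-gon are glued by the word `∏ aᵢ bᵢ aᵢ⁻¹ bᵢ⁻¹`. -/
def orientableGluing (n : ℕ) (p q : Metric.closedBall (0 : ℂ) 1) : Prop :=
  ∃ i < n, ∃ t ∈ Set.Icc (0 : ℝ) 1,
    ((p : ℂ) = polygonEdge (4 * n) (4 * i) t ∧
      (q : ℂ) = polygonEdge (4 * n) (4 * i + 2) (1 - t)) ∨
    ((p : ℂ) = polygonEdge (4 * n) (4 * i + 1) t ∧
      (q : ℂ) = polygonEdge (4 * n) (4 * i + 3) (1 - t))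

/-- The edges of a `2k`-gon are glued by the word `∏ aᵢ aᵢ`. -/
def nonorientableGluing (k : ℕ) (p q : Metric.closedBall (0 : ℂ) 1) : Prop :=
  ∃ i < k, ∃ t ∈ Set.Icc (0 : ℝ) 1,
    (p : ℂ) = polygonEdge (2 * k) (2 * i) t ∧ (q : ℂ) = polygonEdge (2 * k) (2 * i + 1) t

/-- The connected sum of `n ≥ 1` tori. -/
abbrev OrientableSurface (n : ℕ) : Type := Quot (orientableGluing n)

/-- The connected sum of `k ≥ 1` projective planes. -/
abbrev NonorientableSurface (k : ℕ) : Type := Quot (nonorientableGluing k)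

/-- `S` is a closed connected surface, other than the sphere, of genus `g`, where the genus is
normalized by `χ(S) = 2 - 2 g`: it is `n` for the connected sum of `n` tori and `k / 2` for the
connected sum of `k` projective planes. -/
def IsClosedSurfaceOfGenus (S : Type*) [TopologicalSpace S] (g : ℝ) : Prop :=
  (∃ n : ℕ, 0 < n ∧ Nonempty (S ≃ₜ OrientableSurface n) ∧ g = n) ∨
  (∃ k : ℕ, 0 < k ∧ Nonempty (S ≃ₜ NonorientableSurface k) ∧ g = k / 2)

/-! ### Incompressibility -/

/-- `φ` is injective on fundamental groups. -/
def IsIncompressible {X Y : Type*} [TopologicalSpace X] [TopologicalSpace Y] (φ : C(X, Y)) :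
    Prop :=
  ∀ x : X, Function.Injective (FundamentalGroup.map φ x)

/-! ### Pleated surfaces -/

/-- On the interval `I`, the curve `c` is a geodesic of `X` parametrized by arc length. In the
hyperbolic plane and in hyperbolic space geodesics are distance-minimizing, so that this is an
isometric embedding of `I`. Geodesics of a hyperbolic manifold are the projections of these. -/
def IsGeodesicOn {X : Type*} [MetricSpace X] (c : ℝ → X) (I : Set ℝ) : Prop :=
  ∀ s ∈ I, ∀ t ∈ I, dist (c s) (c t) = |s - t|

/-- The arc `c : [0, l] → X` has a closed nowhere dense set of parameters such that it is a
geodesic on (the closure of) each component of the complement of this set. -/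
def IsRectifiableArc {X : Type*} [MetricSpace X] (c : ℝ → X) (l : ℝ) : Prop :=
  ContinuousOn c (Set.Icc 0 l) ∧
  ∃ E ⊆ Set.Icc (0 : ℝ) l, IsClosed E ∧ IsNowhereDense E ∧
    ∀ J ⊆ Set.Icc (0 : ℝ) l \ E, IsPreconnected J → IsGeodesicOn c (closure J)

/-- `(ℍ / Δ, φ)` is a pleated surface in the hyperbolic manifold `HypSpace / Γ`:
* each geodesic segment of the surface (the projection of a geodesic segment `c : [0, l] → ℍ`)
  is mapped to a rectifiable arc of the same length;
* each point of the surface lies on an open geodesic segment which is mapped to a geodesic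
  segment.

Since the projection `HypSpace → HypSpace / Γ` is a covering and a local isometry, length,
rectifiability and being a geodesic are read off from a lift `c'` of the arc to `HypSpace`. -/
structure IsPleatedSurface {Δ Γ : Type*} [Group Δ] [MulAction Δ ℍ] [Group Γ] [MulAction Γ HypSpace]
    (φ : C(OrbitSpace Δ ℍ, OrbitSpace Γ HypSpace)) : Prop where
  isometric : ∀ (l : ℝ) (c : ℝ → ℍ), 0 ≤ l → IsGeodesicOn c (Set.Icc 0 l) →
    ∃ c' : ℝ → HypSpace,
      (∀ t ∈ Set.Icc 0 l, OrbitSpace.proj Γ (c' t) = φ (OrbitSpace.proj Δ (c t))) ∧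
      IsRectifiableArc c' l ∧ eVariationOn c' (Set.Icc 0 l) = ENNReal.ofReal l
  exists_geodesic : ∀ x : OrbitSpace Δ ℍ, ∃ ε > 0, ∃ (c : ℝ → ℍ) (c' : ℝ → HypSpace),
    OrbitSpace.proj Δ (c 0) = x ∧ IsGeodesicOn c (Set.Ioo (-ε) ε) ∧
    (∀ t ∈ Set.Ioo (-ε) ε, OrbitSpace.proj Γ (c' t) = φ (OrbitSpace.proj Δ (c t))) ∧
    IsGeodesicOn c' (Set.Ioo (-ε) ε)

/-! ### Toroidal cusps -/

/-- Two points of a horosphere `H = ∂B` are identified if an element of `Γ` which preserves the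
horoball `B` takes one to the other. -/
def horosphereRel (Γ : Type*) [Group Γ] [MulAction Γ HypSpace] (B H : Set HypSpace) (p q : H) :
    Prop :=
  ∃ γ : Γ, γ • B = B ∧ γ • (p : HypSpace) = q

/-- A toroidal cusp of `HypSpace / Γ`. It is given by a horoball `chart '' {z ≥ 1}` covering it,
where `chart` is an isometry of hyperbolic space. The translates of this horoball under `Γ` have
disjoint interiors, and the quotient of the bounding horosphere by the stabilizer of the horoball
is a torus. -/
structure ToroidalCusp (Γ : Type*) [Group Γ] [MulAction Γ HypSpace] where
  chart : HypSpace ≃ᵢ HypSpace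
  precisely_invariant : ∀ γ : Γ,
    γ • (chart '' {p | 1 ≤ p.z}) = chart '' {p | 1 ≤ p.z} ∨
    Disjoint (γ • (chart '' {p | 1 < p.z})) (chart '' {p | 1 < p.z})
  toroidal : Nonempty
    (Quot (horosphereRel Γ (chart '' {p | 1 ≤ p.z}) (chart '' {p | p.z = 1})) ≃ₜ Circle × Circle)

namespace ToroidalCusp

variable {Γ : Type*} [Group Γ] [MulAction Γ HypSpace]

/-- The horoball covering the cusp. -/
def horoball (N : ToroidalCusp Γ) : Set HypSpace := N.chart '' {p | 1 ≤ p.z}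

/-- The horosphere bounding the horoball. -/
def horosphere (N : ToroidalCusp Γ) : Set HypSpace := N.chart '' {p | p.z = 1}

/-- The cusp, as a subset of the manifold. -/
def carrier (N : ToroidalCusp Γ) : Set (OrbitSpace Γ HypSpace) :=
  OrbitSpace.proj Γ '' N.horoball

/-- The boundary torus of the cusp, as an abstract surface. -/
abbrev Torus (N : ToroidalCusp Γ) : Type := Quot (horosphereRel Γ N.horoball N.horosphere)

/-- The boundary torus as a surface in the manifold. This is an embedding unless two of the
horoballs covering the cusp touch; then the torus touches itself. -/
def torusMap (N : ToroidalCusp Γ) : N.Torus → OrbitSpace Γ HypSpace :=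
  Quot.lift (fun p => OrbitSpace.proj Γ (p : HypSpace)) (by
    rintro p q ⟨γ, -, h⟩
    exact (Quotient.sound (s := MulAction.orbitRel Γ HypSpace) ⟨γ, h⟩).symm)

/-- The depth of a surface `(S, φ)` in the cusp `N`: the supremum of the distances to the boundary
torus from the points of the surface in `N`, and zero if there are none. -/
def depth {S : Type*} (N : ToroidalCusp Γ) (φ : S → OrbitSpace Γ HypSpace) : ℝ≥0∞ :=
  ⨆ (s : S) (_ : φ s ∈ N.carrier), ⨅ t : N.Torus, OrbitSpace.qdist (φ s) (N.torusMap t)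

/-- The surface `(S, φ)` is coannular to the boundary torus of `N`: there is an incompressible
annulus `A` with one boundary component a loop on the surface and the other one a loop on the
torus. -/
def Coannular {S : Type*} [TopologicalSpace S] (N : ToroidalCusp Γ)
    (φ : C(S, OrbitSpace Γ HypSpace)) : Prop :=
  ∃ (A : C(Circle × unitInterval, OrbitSpace Γ HypSpace)) (a : C(Circle, S)) (b : C(Circle, N.Torus)),
    IsIncompressible A ∧ (∀ u, A (u, 0) = φ (a u)) ∧ (∀ u, A (u, 1) = N.torusMap (b u))

end ToroidalCusp

end

/-! Let a point of the surface lie in the cusp at height `z ≥ 1` in the chart of the horoball, and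
put `r = log z`; its distance to the torus is at most `r`. Lift `φ` to `Φ : ℍ → HypSpace` through
this point, with `x` above it. A pleated map is 1-Lipschitz on universal covers and `log z` is
1-Lipschitz, so `Φ` sends the open ball of radius `r` about `x` into the open horoball. If some `δ ≠
1` in `Δ` made this ball meet its translate, the corresponding `γ` in `Γ` would preserve the
horoball, and `γ ≠ 1` by incompressibility. A strip from `Φ` of a path `x → δ x` to a path on the
horosphere would then close up to an incompressible annulus (`coannular_of_lift`). Hence the ball
embeds in the surface.

The ball has area at least `2π (cosh r - 1)`, while the surface has area at most `(m - 2) π`, where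
`m = 4g` is the number of edges of the standard polygon. So `cosh r ≤ 2g`, whence `z < 4g < 2gπ`.

The upper bound for the area replaces Gauss–Bonnet (`exists_triangles_cover`). Lift the polygon to
`ℍ` and straighten it to a fan of geodesic triangles by barycenters. This respects the gluing, hence
induces a continuous equivariant map `ℍ → ℍ` at bounded distance from the identity, which is
surjective by a winding number argument. Thus the translates of the fan cover `ℍ`. Of its `m`
triangles two are degenerate, and each of the others has area at most `π`, being contained in an
ideal triangle. -/

noncomputable section

open scoped UpperHalfPlane Pointwise ENNReal

open MeasureTheory

/-! ### Isometries of the hyperbolic plane -/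

namespace UpperHalfPlane

open scoped MatrixGroups

/-- The rotation about `I` through the angle `2 θ`. -/
def rotation (θ : ℝ) : SL(2, ℝ) :=
  ⟨!![Real.cos θ, Real.sin θ; -Real.sin θ, Real.cos θ], by
    rw [Matrix.det_fin_two_of, ← Real.cos_sq_add_sin_sq θ]; ring⟩

theorem coe_rotation_smul (θ : ℝ) (z : ℍ) : (↑(rotation θ • z) : ℂ) =
    (Real.cos θ * z + Real.sin θ) / (-Real.sin θ * z + Real.cos θ) := by
  rw [coe_specialLinearGroup_apply]
  simp [rotation]

theorem rotation_denom_ne_zero (θ : ℝ) (z : ℍ) :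
    (-(Real.sin θ : ℂ) * z + Real.cos θ) ≠ 0 := by
  have h := linear_ne_zero (cd := ![-Real.sin θ, Real.cos θ]) z (by
    intro h
    have h0 := congrFun h 0
    have h1 := congrFun h 1
    simp only [Matrix.cons_val_zero, Matrix.cons_val_one, Pi.zero_apply, neg_eq_zero] at h0 h1
    have := Real.cos_sq_add_sin_sq θ
    simp [h0, h1] at this)
  simpa using h

theorem rotation_smul_I (θ : ℝ) : rotation θ • I = I := by
  apply UpperHalfPlane.ext
  rw [coe_rotation_smul, div_eq_iff (rotation_denom_ne_zero θ I), coe_I]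
  linear_combination (Real.sin θ : ℂ) * Complex.I_mul_I

theorem continuous_rotation_smul (z : ℍ) : Continuous fun θ => rotation θ • z := by
  rw [isEmbedding_coe.continuous_iff]
  have : (UpperHalfPlane.coe ∘ fun θ => rotation θ • z) = fun θ : ℝ =>
      ((Real.cos θ * z + Real.sin θ) / (-Real.sin θ * z + Real.cos θ) : ℂ) :=
    funext fun θ => coe_rotation_smul θ z
  rw [this]
  refine Continuous.div ?_ ?_ fun θ => rotation_denom_ne_zero θ z
  · fun_prop
  · fun_prop

theorem coe_rotation_pi_div_two_smul (z : ℍ) :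
    ((rotation (Real.pi / 2) • z : ℍ) : ℂ) = -(z : ℂ)⁻¹ := by
  rw [coe_rotation_smul, Real.cos_pi_div_two, Real.sin_pi_div_two]
  simp [div_eq_mul_inv, inv_neg]

/-- Normal form for a pair of points. After `b` is moved to `I`, rotate about `I`: the parameters
`0` and `π / 2` (the half-turn `-1/z`) give real parts of opposite sign, so an intermediate angle
works. A further half-turn moves a point below `I` above it. -/
theorem exists_smul_eq_I_of_re_eq_zero (b c : ℍ) :
    ∃ g : SL(2, ℝ), g • b = I ∧ (g • c).re = 0 ∧ 1 ≤ (g • c).im := by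
  obtain ⟨g₁, hg₁⟩ := MulAction.exists_smul_eq SL(2, ℝ) b I
  set z := g₁ • c with hz
  have hS := coe_rotation_pi_div_two_smul z
  have hre : (rotation (Real.pi / 2) • z).re = -z.re / Complex.normSq z := by
    rw [← coe_re, hS]; simp [neg_div]
  obtain ⟨θ, hθ⟩ : ∃ θ, (rotation θ • z).re = 0 := by
    have hc : Continuous fun θ => (rotation θ • z).re :=
      continuous_re.comp (continuous_rotation_smul z)
    have h0 : (rotation 0 • z).re = z.re := by
      rw [← coe_re, coe_rotation_smul]; simp
    have hn : 0 < Complex.normSq z := Complex.normSq_pos.2 z.ne_zero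
    rcases le_total z.re 0 with h | h
    · exact mem_range_of_exists_le_of_exists_ge hc ⟨0, h0.trans_le h⟩
        ⟨Real.pi / 2, by simp only [hre]; exact div_nonneg (by linarith) hn.le⟩
    · exact mem_range_of_exists_le_of_exists_ge hc
        ⟨Real.pi / 2, by simp only [hre]; exact div_nonpos_of_nonpos_of_nonneg (by linarith) hn.le⟩
        ⟨0, by simpa only [h0] using h⟩
  set w := rotation θ • z
  rcases le_total 1 w.im with h1 | h1
  · exact ⟨rotation θ * g₁, by rw [mul_smul, hg₁, rotation_smul_I], by rw [mul_smul]; exact hθ,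
      by rw [mul_smul]; exact h1⟩
  · have hwS := coe_rotation_pi_div_two_smul w
    have hn : Complex.normSq w = w.im * w.im := by
      rw [Complex.normSq_apply, coe_re, coe_im, hθ]; ring
    refine ⟨rotation (Real.pi / 2) * (rotation θ * g₁), ?_, ?_, ?_⟩
    · rw [mul_smul, mul_smul, hg₁, rotation_smul_I, rotation_smul_I]
    · rw [mul_smul, mul_smul, ← coe_re, hwS]
      simp only [Complex.neg_re, Complex.inv_re, coe_re]
      rw [hθ]; simp
    · rw [mul_smul, mul_smul, ← coe_im, hwS]
      have hp := w.im_pos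
      rw [Complex.neg_im, Complex.inv_im, hn, coe_im, neg_div, neg_neg,
        le_div_iff₀ (by positivity)]
      nlinarith

/-- Distances to two distinct points of an axis determine a point up to reflection in that axis. The
condition `1 < s` makes the two equations independent, through the factor `s ^ 2 - 1`. -/
theorem sq_re_eq_of_dist_I_eq {z w : ℍ} {s : ℝ} (hs : 1 < s) {p : ℍ} (hp : p.re = 0)
    (hp' : p.im = s) (h1 : dist z I = dist w I) (h2 : dist z p = dist w p) :
    z.im = w.im ∧ z.re ^ 2 = w.re ^ 2 := by
  have e1 := congrArg Real.cosh h1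
  have e2 := congrArg Real.cosh h2
  rw [cosh_dist', cosh_dist'] at e1 e2
  have hz := z.im_pos
  have hw := w.im_pos
  rw [div_eq_div_iff (by positivity) (by positivity)] at e1 e2
  simp only [I_re, I_im, hp, hp', sub_zero] at e1 e2
  have h3 : (s ^ 2 - 1) * w.im = (s ^ 2 - 1) * z.im := by
    have hs0 : s ≠ 0 := by positivity
    apply mul_left_cancel₀ hs0
    linear_combination (1/2) * e2 - (s / 2) * e1
  have h4 : w.im = z.im := mul_left_cancel₀ (by nlinarith) h3
  refine ⟨h4.symm, ?_⟩
  rw [h4] at e1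
  have : 2 * z.im * (z.re ^ 2) = 2 * z.im * (w.re ^ 2) := by linear_combination e1
  exact mul_left_cancel₀ (by positivity) this

theorem isometry_J_smul : Isometry fun z : ℍ => J • z := by
  refine Isometry.of_dist_eq fun z w => ?_
  have hz : (J • z).im = z.im := by rw [← coe_im, coe_J_smul]; simp
  have hw : (J • w).im = w.im := by rw [← coe_im, coe_J_smul]; simp
  rw [dist_eq, dist_eq, hz, hw, coe_J_smul, coe_J_smul]
  congr 3
  rw [Complex.dist_eq, Complex.dist_eq, ← Complex.norm_conj]
  rw [← norm_neg]
  simp; ring_nf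

/-- Correct `f` by `SL(2, ℝ)` so that it fixes `I` and `2i`. It then fixes `1 + i`, possibly after
composition with the reflection `J`, and distances to these three points determine every point. This
gives invariance of area under all of `Δ`, reflections included. -/
theorem exists_eq_smul_of_isometry {f : ℍ → ℍ} (hf : Isometry f) :
    ∃ g : GL (Fin 2) ℝ, ∀ z, f z = g • z := by
  let p : ℍ := ⟨⟨0, 2⟩, two_pos⟩
  let q : ℍ := ⟨⟨1, 1⟩, one_pos⟩
  obtain ⟨g, hg1, hg2, hg3⟩ := exists_smul_eq_I_of_re_eq_zero (f I) (f p)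
  have hgi : Isometry fun z : ℍ => g • z := isometry_smul ℍ g
  have hh : Isometry fun z : ℍ => g • f z := hgi.comp hf
  have hp : g • f p = p := by
    have h1 : dist (g • f p) I = dist p I := by
      conv_lhs => rw [← hg1]
      exact hh.dist_eq p I
    rw [dist_of_re_eq (by rw [hg2]; rfl), dist_of_re_eq (by rfl)] at h1
    have h2 : Real.log (g • f p).im = Real.log 2 := by
      have e : p.im = 2 := rfl
      rw [e, I_im, Real.log_one, dist_zero_right, dist_zero_right, Real.norm_of_nonneg
        (Real.log_nonneg hg3), Real.norm_of_nonneg (Real.log_nonneg one_le_two)] at h1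
      exact h1
    have h3 := Real.log_injOn_pos (Set.mem_Ioi.2 (g • f p).im_pos) (Set.mem_Ioi.2 two_pos) h2
    exact UpperHalfPlane.ext (Complex.ext (by rw [coe_re, hg2]) (by rw [coe_im, h3]))
  have key (k : ℍ → ℍ) (hk : Isometry k) (hk1 : k I = I) (hk2 : k p = p) (z : ℍ) :
      (k z).im = z.im ∧ (k z).re ^ 2 = z.re ^ 2 :=
    sq_re_eq_of_dist_I_eq (s := 2) (p := p) one_lt_two rfl rfl
      (by conv_lhs => rw [← hk1]
          exact hk.dist_eq _ _)
      (by conv_lhs => rw [← hk2]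
          exact hk.dist_eq _ _)
  have fixq (k : ℍ → ℍ) (hk : Isometry k) (hk1 : k I = I) (hk2 : k p = p) (hk3 : k q = q)
      (z : ℍ) : k z = z := by
    obtain ⟨h1, h2⟩ := key k hk hk1 hk2 z
    have h3 : dist (k z) q = dist z q := by
      conv_lhs => rw [← hk3]
      exact hk.dist_eq _ _
    have e := congrArg Real.cosh h3
    rw [cosh_dist', cosh_dist', h1] at e
    have hz := z.im_pos
    have hq := q.im_pos
    rw [div_left_inj' (by positivity)] at e
    have e1 : q.re = 1 := rfl
    rw [e1] at e
    exact UpperHalfPlane.ext (Complex.ext (by simp only [coe_re]; linarith) (by simpa using h1))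
  have hJp : J • p = p := by
    apply UpperHalfPlane.ext; rw [coe_J_smul]; apply Complex.ext <;> simp [p]
  have hJI : J • I = I := by
    apply UpperHalfPlane.ext; rw [coe_J_smul]; apply Complex.ext <;> simp
  obtain ⟨h1, h2⟩ := key _ hh hg1 hp q
  have h2' : (g • f q).re = 1 ∨ (g • f q).re = -1 := by
    have e1 : q.re = 1 := rfl
    rw [e1, one_pow] at h2
    simpa using h2
  rcases h2' with h | h
  · refine ⟨(g : GL (Fin 2) ℝ)⁻¹, fun z => ?_⟩
    have := fixq _ hh hg1 hp (UpperHalfPlane.ext (Complex.ext h h1)) z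
    rw [eq_inv_smul_iff]
    exact this
  · refine ⟨(J * (g : GL (Fin 2) ℝ))⁻¹, fun z => ?_⟩
    have := fixq _ (isometry_J_smul.comp hh) (by simp [hg1, hJI]) (by simp [hp, hJp])
      (UpperHalfPlane.ext (by
        simp only [Function.comp_apply, coe_J_smul]
        exact Complex.ext (by simp [h]; rfl) (by simp [h1]))) z
    rw [eq_inv_smul_iff, mul_smul]
    exact this

theorem volume_preimage_of_isometry {f : ℍ → ℍ} (hf : Isometry f) (s : Set ℍ) :
    volume (f ⁻¹' s) = volume s := by
  obtain ⟨g, hg⟩ := exists_eq_smul_of_isometry hf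
  have : f = fun z => g • z := funext hg
  rw [this, measure_preimage_smul]

end UpperHalfPlane

/-! ### Areas in the hyperbolic plane -/

theorem setLIntegral_Ioo_ofReal_of_hasDerivAt {f f' : ℝ → ℝ} {a b : ℝ} (hab : a ≤ b)
    (hf : ContinuousOn f (Set.Icc a b)) (hf' : ∀ x ∈ Set.Ioo a b, HasDerivAt f (f' x) x)
    (h0 : ∀ x ∈ Set.Ioo a b, 0 ≤ f' x) :
    ∫⁻ x in Set.Ioo a b, ENNReal.ofReal (f' x) = ENNReal.ofReal (f b - f a) := by
  have hfi := intervalIntegral.integrableOn_deriv_of_nonneg hf hf' h0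
  have h := intervalIntegral.integral_eq_sub_of_hasDerivAt_of_le hab hf hf'
    ((intervalIntegrable_iff_integrableOn_Ioc_of_le hab).2 hfi)
  rw [← h, intervalIntegral.integral_of_le hab, ← integral_Ioc_eq_integral_Ioo.symm,
    ofReal_integral_eq_lintegral_ofReal (hfi.mono_set Set.Ioo_subset_Ioc_self)]
  exact ae_restrict_of_forall_mem measurableSet_Ioo h0

theorem setLIntegral_Ioi_ofReal_inv_sq {a : ℝ} (ha : 0 < a) :
    ∫⁻ y in Set.Ioi a, ENNReal.ofReal (1 / y ^ 2) = ENNReal.ofReal (1 / a) := by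
  have hd : ∀ x ∈ Set.Ici a, HasDerivAt (fun y : ℝ => -y⁻¹) (1 / x ^ 2) x := fun x hx => by
    simpa using (hasDerivAt_inv (ha.trans_le hx).ne').fun_neg
  have h0 : ∀ x ∈ Set.Ioi a, 0 ≤ 1 / x ^ 2 := fun x _ => by positivity
  have hl : Filter.Tendsto (fun y : ℝ => -y⁻¹) Filter.atTop (nhds 0) := by
    simpa using (tendsto_inv_atTop_zero (𝕜 := ℝ)).neg
  rw [← ofReal_integral_eq_lintegral_ofReal (integrableOn_Ioi_deriv_of_nonneg' hd h0 hl)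
    (ae_restrict_of_forall_mem measurableSet_Ioi h0),
    integral_Ioi_of_hasDerivAt_of_nonneg' hd h0 hl]
  simp

theorem setLIntegral_Ioo_ofReal_inv_sq {a b : ℝ} (ha : 0 < a) (hab : a ≤ b) :
    ∫⁻ y in Set.Ioo a b, ENNReal.ofReal (1 / y ^ 2) = ENNReal.ofReal (1 / a - 1 / b) := by
  rw [setLIntegral_Ioo_ofReal_of_hasDerivAt (f := fun y : ℝ => -y⁻¹) hab]
  · congr 1; simp only [one_div]; ring
  · exact (continuousOn_inv₀.mono fun x hx => (ha.trans_le hx.1).ne').neg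
  · intro x hx
    simpa using (hasDerivAt_inv (ha.trans hx.1).ne').fun_neg
  · intro x _; positivity

namespace UpperHalfPlane

open scoped MatrixGroups

theorem volume_eq_lintegral_lintegral {s : Set ℍ} {t : Set (ℝ × ℝ)} (ht : MeasurableSet t)
    (hst : ∀ z : ℍ, z ∈ s ↔ (z.re, z.im) ∈ t) (hpos : ∀ q ∈ t, 0 < q.2) :
    volume s = ∫⁻ x : ℝ, ∫⁻ y in {y | (x, y) ∈ t}, ENNReal.ofReal (1 / y ^ 2) := by
  have himg : (UpperHalfPlane.coe '' s) = Complex.measurableEquivRealProd ⁻¹' t := by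
    ext w
    constructor
    · rintro ⟨z, hz, rfl⟩
      exact (hst z).1 hz
    · intro hw
      have hw0 : 0 < w.im := hpos _ hw
      exact ⟨⟨w, hw0⟩, (hst _).2 hw, rfl⟩
  have hF : Measurable fun q : ℝ × ℝ => ENNReal.ofReal (1 / q.2 ^ 2) := by fun_prop
  have h1 : volume s = ∫⁻ z in Complex.measurableEquivRealProd ⁻¹' t,
      (fun q : ℝ × ℝ => ENNReal.ofReal (1 / q.2 ^ 2)) (Complex.measurableEquivRealProd z) := by
    rw [volume_eq_lintegral, himg]
    congr 1
    ext z
    have : ENNReal.ofReal (1 / z.im ^ 2) = (((1 / ‖z.im‖₊) ^ 2 : NNReal) : ℝ≥0∞) := by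
      rw [← ENNReal.ofReal_coe_nnreal]
      congr 1
      push_cast
      rw [div_pow, one_pow, Real.norm_eq_abs, sq_abs]
    simpa using this.symm
  rw [h1, Complex.volume_preserving_equiv_real_prod.setLIntegral_comp_preimage ht hF,
    ← lintegral_indicator ht, Measure.volume_eq_prod, lintegral_prod _
      (hF.indicator ht).aemeasurable]
  congr 1
  ext x
  have hm : MeasurableSet {y | (x, y) ∈ t} := measurable_prodMk_left ht
  rw [← lintegral_indicator hm]
  rfl

theorem hasDerivAt_ballPrimitive {S C x : ℝ} (hS : 0 < S) (hC : C ^ 2 = 1 + S ^ 2)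
    (hx : x ∈ Set.Ioo (-S) S) :
    HasDerivAt (fun x => 2 * (C * Real.arcsin (x * C / (S * √(1 + x ^ 2))) - Real.arcsin (x / S)))
      (2 * √(S ^ 2 - x ^ 2) / (1 + x ^ 2)) x := by
  have hr : 0 < S ^ 2 - x ^ 2 := by nlinarith [hx.1, hx.2]
  have hq : 0 < 1 + x ^ 2 := by positivity
  set r := √(S ^ 2 - x ^ 2) with hrdef
  set q := √(1 + x ^ 2) with hqdef
  have hr0 : 0 < r := Real.sqrt_pos.2 hr
  have hq0 : 0 < q := Real.sqrt_pos.2 hq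
  have hr2 : r ^ 2 = S ^ 2 - x ^ 2 := Real.sq_sqrt hr.le
  have hq2 : q ^ 2 = 1 + x ^ 2 := Real.sq_sqrt hq.le
  have hu1 : 1 - (x * C / (S * q)) ^ 2 = (r / (S * q)) ^ 2 := by
    field_simp
    rw [hr2, hq2]
    linear_combination -x ^ 2 * hC
  have hv1 : 1 - (x / S) ^ 2 = (r / S) ^ 2 := by
    field_simp
    rw [hr2]
  have habs {u v : ℝ} (hv : 0 < v) (h : 1 - u ^ 2 = v ^ 2) : u ≠ -1 ∧ u ≠ 1 := by
    constructor <;> rintro rfl <;> nlinarith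
  have dq : HasDerivAt (fun x : ℝ => √(1 + x ^ 2)) (x / q) x := by
    have h1 : HasDerivAt (fun x : ℝ => 1 + x ^ 2) (2 * x) x := by
      simpa using ((hasDerivAt_id x).pow 2).const_add 1
    have := h1.sqrt hq.ne'
    convert this using 1
    rw [← hqdef]
    field_simp
  have du : HasDerivAt (fun x : ℝ => x * C / (S * √(1 + x ^ 2)))
      ((C * (S * q) - x * C * (S * (x / q))) / (S * q) ^ 2) x := by
    have h1 : HasDerivAt (fun x : ℝ => x * C) C x := by
      simpa using (hasDerivAt_id x).mul_const C
    exact h1.div (dq.const_mul S) (by positivity)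
  obtain ⟨hu2, hu3⟩ := habs (by positivity : 0 < r / (S * q)) hu1
  obtain ⟨hv2, hv3⟩ := habs (by positivity : 0 < r / S) hv1
  have d1 := (Real.hasDerivAt_arcsin hu2 hu3).comp x du
  have d2 := (Real.hasDerivAt_arcsin hv2 hv3).comp x ((hasDerivAt_id x).div_const S)
  have d := ((d1.const_mul C).sub d2).const_mul 2
  refine d.congr_deriv ?_
  rw [hu1, hv1, Real.sqrt_sq (by positivity), Real.sqrt_sq (by positivity), ← hq2]
  field_simp
  rw [hr2]
  have : C ^ 2 * (q ^ 2 - x ^ 2) = 1 + S ^ 2 := by rw [hq2, hC]; ring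
  rw [this, hq2]
  ring

/-- The ball is the Euclidean disk with center `iC` and radius `S`. With `ρ = √(S ^ 2 - x ^ 2)`, its
vertical slice at `x` has weight `1/(C-ρ) - 1/(C+ρ) = 2ρ/(1+x²)`, whose primitive is explicit. At `x
= ±S` all arcsines are `±π/2`. -/
theorem volume_ball_I {r : ℝ} (hr : 0 < r) :
    ENNReal.ofReal (2 * Real.pi * (Real.cosh r - 1)) ≤ volume (Metric.ball I r) := by
  set S := Real.sinh r with hSdef
  set C := Real.cosh r with hCdef
  have hS : 0 < S := Real.sinh_pos_iff.2 hr
  have hC0 : 0 < C := Real.cosh_pos r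
  have hC : C ^ 2 = 1 + S ^ 2 := by rw [hCdef, Real.cosh_sq]; ring
  let t : Set (ℝ × ℝ) := {q | q.1 ^ 2 + (q.2 - C) ^ 2 < S ^ 2}
  have ht : MeasurableSet t := (isOpen_lt (by fun_prop) (by fun_prop)).measurableSet
  have hst (z : ℍ) : z ∈ Metric.ball I r ↔ (z.re, z.im) ∈ t := by
    rw [Metric.mem_ball, dist_lt_iff_dist_coe_center_lt, I_im, one_mul,
      ← sq_lt_sq₀ dist_nonneg hS.le, Complex.dist_eq, Complex.sq_norm, Complex.normSq_apply]
    simp [t, ← sq, hCdef]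
  have hpos : ∀ q ∈ t, 0 < q.2 := by
    intro q hq
    have hq : q.1 ^ 2 + (q.2 - C) ^ 2 < S ^ 2 := hq
    by_contra! h
    nlinarith [sq_nonneg q.1]
  rw [volume_eq_lintegral_lintegral ht hst hpos]
  have hsec : ∀ x ∈ Set.Ioo (-S) S, ∫⁻ y in {y | (x, y) ∈ t}, ENNReal.ofReal (1 / y ^ 2) =
      ENNReal.ofReal (2 * √(S ^ 2 - x ^ 2) / (1 + x ^ 2)) := by
    intro x hx
    have hr : 0 < S ^ 2 - x ^ 2 := by nlinarith [hx.1, hx.2]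
    set ρ := √(S ^ 2 - x ^ 2) with hρ
    have hρ0 : 0 < ρ := Real.sqrt_pos.2 hr
    have hρ2 : ρ ^ 2 = S ^ 2 - x ^ 2 := Real.sq_sqrt hr.le
    have hρC : ρ < C := by nlinarith [sq_nonneg x]
    have hset : {y | (x, y) ∈ t} = Set.Ioo (C - ρ) (C + ρ) := by
      ext y
      simp only [t, Set.mem_ofPred_eq, Set.mem_Ioo]
      have : x ^ 2 + (y - C) ^ 2 < S ^ 2 ↔ (y - C) ^ 2 < ρ ^ 2 := by
        rw [hρ2]; constructor <;> intro h <;> linarith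
      rw [this, sq_lt_sq, abs_of_pos hρ0, abs_lt]
      constructor <;> rintro ⟨h1, h2⟩ <;> constructor <;> linarith
    rw [hset, setLIntegral_Ioo_ofReal_inv_sq (by linarith) (by linarith)]
    congr 1
    have h1 : C - ρ ≠ 0 := by linarith
    have h2 : C + ρ ≠ 0 := by linarith
    have h3 : 1 + x ^ 2 ≠ 0 := by positivity
    field_simp
    linear_combination (-2) * ρ * hC + 2 * ρ * hρ2
  calc ENNReal.ofReal (2 * Real.pi * (C - 1))
      = ∫⁻ x in Set.Ioo (-S) S, ENNReal.ofReal (2 * √(S ^ 2 - x ^ 2) / (1 + x ^ 2)) := by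
        rw [setLIntegral_Ioo_ofReal_of_hasDerivAt (by linarith) _
          (fun x hx => hasDerivAt_ballPrimitive hS hC hx) (fun x _ => by positivity)]
        · have hCs : √(1 + S ^ 2) = C := by rw [← hC, Real.sqrt_sq hC0.le]
          have e1 : S * C / (S * √(1 + S ^ 2)) = 1 := by rw [hCs]; field_simp
          have e2 : -S * C / (S * √(1 + (-S) ^ 2)) = -1 := by rw [neg_sq, hCs]; field_simp
          have e3 : S / S = 1 := div_self hS.ne'
          have e4 : -S / S = -1 := by rw [neg_div, e3]
          rw [e1, e2, e3, e4, Real.arcsin_one, Real.arcsin_neg_one]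
          congr 1; ring
        · have hq (x : ℝ) : S * √(1 + x ^ 2) ≠ 0 :=
            mul_ne_zero hS.ne' (Real.sqrt_pos.2 (by positivity)).ne'
          have := Real.continuous_arcsin
          refine Continuous.continuousOn (Continuous.mul continuous_const (Continuous.sub ?_ ?_))
          · exact continuous_const.mul (this.comp (Continuous.div (by fun_prop) (by fun_prop) hq))
          · exact this.comp (by fun_prop)
    _ = ∫⁻ x in Set.Ioo (-S) S, ∫⁻ y in {y | (x, y) ∈ t}, ENNReal.ofReal (1 / y ^ 2) :=
        (setLIntegral_congr_fun measurableSet_Ioo hsec).symm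
    _ ≤ _ := setLIntegral_le_lintegral _ _

theorem le_volume_ball (p : ℍ) {r : ℝ} (hr : 0 < r) :
    ENNReal.ofReal (2 * Real.pi * (Real.cosh r - 1)) ≤ volume (Metric.ball p r) := by
  obtain ⟨g, hg⟩ := MulAction.exists_smul_eq SL(2, ℝ) p I
  rw [← volume_preimage_of_isometry (isometry_smul ℍ g⁻¹), Set.preimage_smul, inv_inv,
    Metric.smul_ball, hg]
  exact volume_ball_I hr

/-- The region above the half-circle of radius `R` with center `x₀`: an ideal triangle with a
vertex at infinity. -/
theorem volume_ideal_triangle (x₀ : ℝ) {R : ℝ} (hR : 0 < R) :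
    volume {z : ℍ | (z.re - x₀) ^ 2 ≤ R ^ 2 ∧ R ^ 2 ≤ (z.re - x₀) ^ 2 + z.im ^ 2} ≤
      ENNReal.ofReal Real.pi := by
  let t : Set (ℝ × ℝ) := {q | 0 < q.2} ∩ {q | (q.1 - x₀) ^ 2 ≤ R ^ 2} ∩
    {q | R ^ 2 ≤ (q.1 - x₀) ^ 2 + q.2 ^ 2}
  have ht : MeasurableSet t := ((isOpen_lt (by fun_prop) (by fun_prop)).measurableSet.inter
    (isClosed_le (by fun_prop) (by fun_prop)).measurableSet).inter
    (isClosed_le (by fun_prop) (by fun_prop)).measurableSet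
  rw [volume_eq_lintegral_lintegral ht (fun z => by simp [t, z.im_pos]) (fun q hq => hq.1.1)]
  set g : ℝ → ℝ≥0∞ := fun x => ∫⁻ y in {y | (x, y) ∈ t}, ENNReal.ofReal (1 / y ^ 2)
  have hg0 : ∀ x ∉ Set.Icc (x₀ - R) (x₀ + R), g x = 0 := by
    intro x hx
    have : {y | (x, y) ∈ t} = ∅ := by
      ext y
      simp only [t, Set.mem_inter_iff, Set.mem_ofPred_eq, Set.mem_empty_iff_false, iff_false]
      rintro ⟨⟨-, h⟩, -⟩
      exact hx ⟨by linarith [(abs_le_of_sq_le_sq' h hR.le).1],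
        by linarith [(abs_le_of_sq_le_sq' h hR.le).2]⟩
    simp [g, this]
  have hg1 : ∀ x ∈ Set.Ioo (x₀ - R) (x₀ + R),
      g x = ENNReal.ofReal (1 / √(R ^ 2 - (x - x₀) ^ 2)) := by
    intro x hx
    have hr : 0 < R ^ 2 - (x - x₀) ^ 2 := by nlinarith [hx.1, hx.2]
    have : {y | (x, y) ∈ t} = Set.Ici (√(R ^ 2 - (x - x₀) ^ 2)) := by
      ext y
      simp only [t, Set.mem_inter_iff, Set.mem_ofPred_eq, Set.mem_Ici]
      constructor
      · rintro ⟨⟨h1, -⟩, h2⟩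
        exact Real.sqrt_le_iff.2 ⟨h1.le, by linarith⟩
      · intro h
        have hy := (Real.sqrt_pos.2 hr).trans_le h
        exact ⟨⟨hy, by linarith⟩, by linarith [(Real.sqrt_le_left hy.le).1 h]⟩
    simp only [g, this]
    rw [setLIntegral_congr Ioi_ae_eq_Ici.symm, setLIntegral_Ioi_ofReal_inv_sq (Real.sqrt_pos.2 hr)]
  have hind : g = (Set.Icc (x₀ - R) (x₀ + R)).indicator g := by
    ext x
    by_cases hx : x ∈ Set.Icc (x₀ - R) (x₀ + R)
    · rw [Set.indicator_of_mem hx]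
    · rw [Set.indicator_of_notMem hx, hg0 x hx]
  rw [hind, lintegral_indicator measurableSet_Icc, setLIntegral_congr Ioo_ae_eq_Icc.symm,
    setLIntegral_congr_fun measurableSet_Ioo hg1,
    setLIntegral_Ioo_ofReal_of_hasDerivAt (f := fun x => Real.arcsin ((x - x₀) / R))
      (by linarith) (by
        refine (Real.continuous_arcsin.comp ?_).continuousOn
        fun_prop) _ (fun x _ => by positivity)]
  · have e1 : (x₀ + R - x₀) / R = 1 := by field_simp; ring
    have e2 : (x₀ - R - x₀) / R = -1 := by field_simp; ring
    simp only [e1, e2, Real.arcsin_one, Real.arcsin_neg_one]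
    apply le_of_eq; congr 1; ring
  · intro x hx
    have hr : 0 < R ^ 2 - (x - x₀) ^ 2 := by nlinarith [hx.1, hx.2]
    have hr0 := Real.sqrt_pos.2 hr
    have hv1 : 1 - ((x - x₀) / R) ^ 2 = (√(R ^ 2 - (x - x₀) ^ 2) / R) ^ 2 := by
      rw [div_pow, div_pow, Real.sq_sqrt hr.le]; field_simp
    have hv : (x - x₀) / R ≠ -1 ∧ (x - x₀) / R ≠ 1 := by
      have : 0 < (√(R ^ 2 - (x - x₀) ^ 2) / R) ^ 2 := by positivity
      constructor <;> intro h <;> rw [h] at hv1 <;> linarith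
    have d := (Real.hasDerivAt_arcsin hv.1 hv.2).comp x
      (((hasDerivAt_id x).sub_const x₀).div_const R)
    refine d.congr_deriv ?_
    rw [hv1, Real.sqrt_sq (by positivity)]
    field_simp

theorem volume_re_eq_zero : volume {z : ℍ | z.re = 0} = 0 := by
  let t : Set (ℝ × ℝ) := {q | 0 < q.2} ∩ {q | q.1 = 0}
  have ht : MeasurableSet t := (isOpen_lt (by fun_prop) (by fun_prop)).measurableSet.inter
    (isClosed_eq (by fun_prop) (by fun_prop)).measurableSet
  rw [volume_eq_lintegral_lintegral ht (fun z => by simp [t, z.im_pos]) (fun q hq => hq.1)]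
  rw [← lintegral_zero (μ := (volume : Measure ℝ))]
  refine lintegral_congr_ae ?_
  filter_upwards [Measure.ae_ne volume (0 : ℝ)] with x hx
  simp [t, hx]

/-- The geodesic triangle with vertices `a`, `b`, `c`: in the hyperboloid model, the points of the
convex cone spanned by the vertices. -/
def geodesicTriangle (a b c : ℍ) : Set ℍ :=
  {q | ∃ k l m : ℝ, 0 ≤ k ∧ 0 ≤ l ∧ 0 ≤ m ∧ ∀ v, Real.cosh (dist q v) =
    k * Real.cosh (dist a v) + l * Real.cosh (dist b v) + m * Real.cosh (dist c v)}

theorem smul_mem_geodesicTriangle {G : Type*} [Group G] [MulAction G ℍ] [IsIsometricSMul G ℍ]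
    (g : G) {a b c q : ℍ} (h : q ∈ geodesicTriangle a b c) :
    g • q ∈ geodesicTriangle (g • a) (g • b) (g • c) := by
  obtain ⟨k, l, m, hk, hl, hm, h⟩ := h
  refine ⟨k, l, m, hk, hl, hm, fun v => ?_⟩
  have := h (g⁻¹ • v)
  have e (w : ℍ) : dist w (g⁻¹ • v) = dist (g • w) v := by
    rw [← dist_smul g, smul_inv_smul]
  simpa only [e] using this

/-- The distance in the hyperboloid model, where `z` is the vector `(1, re z, |z|²) / im z`. -/
theorem two_mul_im_mul_cosh_dist (z v : ℍ) : 2 * v.im * Real.cosh (dist z v) =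
    (z.re ^ 2 + z.im ^ 2) / z.im - 2 * (z.re / z.im) * v.re
      + 1 / z.im * (v.re ^ 2 + v.im ^ 2) := by
  have hz := z.im_pos
  have hv := v.im_pos
  rw [cosh_dist']
  field_simp
  ring

theorem geodesicTriangle_coords {a b c q : ℍ} (h : q ∈ geodesicTriangle a b c) :
    ∃ k l m : ℝ, 0 ≤ k ∧ 0 ≤ l ∧ 0 ≤ m ∧
      1 / q.im = k * (1 / a.im) + l * (1 / b.im) + m * (1 / c.im) ∧
      q.re / q.im = k * (a.re / a.im) + l * (b.re / b.im) + m * (c.re / c.im) ∧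
      (q.re ^ 2 + q.im ^ 2) / q.im = k * ((a.re ^ 2 + a.im ^ 2) / a.im) +
        l * ((b.re ^ 2 + b.im ^ 2) / b.im) + m * ((c.re ^ 2 + c.im ^ 2) / c.im) := by
  obtain ⟨k, l, m, hk, hl, hm, h⟩ := h
  refine ⟨k, l, m, hk, hl, hm, ?_⟩
  have key (s y : ℝ) (hy : 0 < y) : (q.re ^ 2 + q.im ^ 2) / q.im - 2 * (q.re / q.im) * s
      + 1 / q.im * (s ^ 2 + y ^ 2) = k * ((a.re ^ 2 + a.im ^ 2) / a.im - 2 * (a.re / a.im) * s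
      + 1 / a.im * (s ^ 2 + y ^ 2)) + l * ((b.re ^ 2 + b.im ^ 2) / b.im - 2 * (b.re / b.im) * s
      + 1 / b.im * (s ^ 2 + y ^ 2)) + m * ((c.re ^ 2 + c.im ^ 2) / c.im - 2 * (c.re / c.im) * s
      + 1 / c.im * (s ^ 2 + y ^ 2)) := by
    have h1 := congrArg (fun r => 2 * y * r) (h ⟨⟨s, y⟩, hy⟩)
    have e (w : ℍ) : 2 * y * Real.cosh (dist w ⟨⟨s, y⟩, hy⟩) = _ :=
      two_mul_im_mul_cosh_dist w ⟨⟨s, y⟩, hy⟩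
    have h2 := e q
    have ha := e a
    have hb := e b
    have hc := e c
    simp only [mk_re, mk_im] at h2 ha hb hc
    linear_combination h1 - h2 + k * ha + l * hb + m * hc
  -- The test points `i`, `2i`, `1 + i` separate the three coefficients in the hyperboloid formula.
  have k1 := key 0 1 one_pos
  have k2 := key 0 2 two_pos
  have k3 := key 1 1 one_pos
  norm_num at k1 k2 k3
  simp only [one_div]
  refine ⟨by linarith, by linarith, by linarith⟩

theorem nonneg_of_div_nonneg {a b : ℝ} (hb : 0 < b) (h : 0 ≤ a / b) : 0 ≤ a := by
  simpa [div_mul_cancel₀ a hb.ne'] using mul_nonneg h hb.le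

/-- With `b` at `I` and `c` on the vertical ray above it, the triangle lies above the half-circle
through `a` and `I` and between the verticals at its ends. Each of these three conditions, divided
by the height, is linear in hyperboloid coordinates, so it only has to be checked at the vertices.
-/
theorem volume_geodesicTriangle_le (a b c : ℍ) :
    volume (geodesicTriangle a b c) ≤ ENNReal.ofReal Real.pi := by
  obtain ⟨g, hb, hc, hc'⟩ := exists_smul_eq_I_of_re_eq_zero b c
  have hsub : geodesicTriangle a b c ⊆
      (fun z => g • z) ⁻¹' geodesicTriangle (g • a) (g • b) (g • c) :=
    fun q hq => smul_mem_geodesicTriangle g hq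
  refine (measure_mono hsub).trans ?_
  rw [volume_preimage_of_isometry (isometry_smul ℍ g), hb]
  set a' := g • a
  set c' := g • c
  have ha' := a'.im_pos
  by_cases h0 : a'.re = 0
  · refine (measure_mono (t := {z : ℍ | z.re = 0}) fun q hq => ?_).trans
      (by rw [volume_re_eq_zero]; exact zero_le)
    obtain ⟨k, l, m, -, -, -, -, h, -⟩ := geodesicTriangle_coords hq
    simpa [h0, hc, q.im_ne_zero] using h
  -- The point of the real axis at equal Euclidean distance from `a'` and `I`.
  · set x₀ := (a'.re ^ 2 + a'.im ^ 2 - 1) / (2 * a'.re) with hx₀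
    have hx : 2 * a'.re * x₀ = a'.re ^ 2 + a'.im ^ 2 - 1 := by rw [hx₀]; field_simp
    have hR2 : 0 < 1 + x₀ ^ 2 := by positivity
    set R := √(1 + x₀ ^ 2)
    have hR : 0 < R := Real.sqrt_pos.2 hR2
    have hRR : R ^ 2 = 1 + x₀ ^ 2 := Real.sq_sqrt hR2.le
    obtain ⟨ha1, ha2⟩ : -R ≤ a'.re - x₀ ∧ a'.re - x₀ ≤ R :=
      abs_le_of_sq_le_sq' (by nlinarith) hR.le
    obtain ⟨hx1, hx2⟩ : -R ≤ -x₀ ∧ -x₀ ≤ R := abs_le_of_sq_le_sq' (by nlinarith) hR.le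
    refine (measure_mono fun q hq => ?_).trans (volume_ideal_triangle x₀ hR)
    obtain ⟨k, l, m, hk, hl, hm, h1, h2, h3⟩ := geodesicTriangle_coords hq
    have hq0 := q.im_pos
    have hc0 := c'.im_pos
    simp only [I_im, I_re, hc] at h1 h2 h3
    have e1 : (q.re - x₀ + R) / q.im =
        k * ((a'.re - x₀ + R) / a'.im) + l * (-x₀ + R) + m * ((-x₀ + R) / c'.im) := by
      linear_combination h2 + (R - x₀) * h1
    have e2 : (R - (q.re - x₀)) / q.im =
        k * ((R - (a'.re - x₀)) / a'.im) + l * (R + x₀) + m * ((R + x₀) / c'.im) := by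
      linear_combination -h2 + (R + x₀) * h1
    have e3 : ((q.re - x₀) ^ 2 + q.im ^ 2 - R ^ 2) / q.im = m * ((c'.im ^ 2 - 1) / c'.im) := by
      have e4 : (a'.re ^ 2 + a'.im ^ 2 - 2 * x₀ * a'.re - 1) / a'.im = 0 := by
        rw [div_eq_zero_iff]; left; linarith
      rw [hRR]
      linear_combination h3 - 2 * x₀ * h2 - h1 + k * e4
    have p1 : 0 ≤ (q.re - x₀ + R) / q.im := by
      rw [e1]
      have := div_nonneg (by linarith : 0 ≤ a'.re - x₀ + R) ha'.le
      have := div_nonneg (by linarith : 0 ≤ -x₀ + R) hc0.le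
      have : 0 ≤ -x₀ + R := by linarith
      positivity
    have p2 : 0 ≤ (R - (q.re - x₀)) / q.im := by
      rw [e2]
      have := div_nonneg (by linarith : 0 ≤ R - (a'.re - x₀)) ha'.le
      have := div_nonneg (by linarith : 0 ≤ R + x₀) hc0.le
      have : 0 ≤ R + x₀ := by linarith
      positivity
    have p3 : 0 ≤ ((q.re - x₀) ^ 2 + q.im ^ 2 - R ^ 2) / q.im := by
      rw [e3]
      exact mul_nonneg hm (div_nonneg (by nlinarith) hc0.le)
    have q1 := nonneg_of_div_nonneg hq0 p1
    have q2 := nonneg_of_div_nonneg hq0 p2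
    have q3 := nonneg_of_div_nonneg hq0 p3
    exact ⟨sq_le_sq' (by linarith) (by linarith), by linarith⟩

end UpperHalfPlane

/-! ### Maps of the hyperbolic plane at bounded distance from the identity -/

/-- A nowhere vanishing `G` on the plane has a continuous logarithm. On the unit circle `G u / (ρ
u)` stays in the disk of radius one about `1`, so subtracting its principal logarithm leaves a
`2π`-periodic continuous logarithm of `ρ e^{iθ}`. By uniqueness of lifts that logarithm is a
constant plus `iθ`, which is not periodic. -/
theorem false_of_norm_sub_lt_on_circle {G : ℂ → ℂ} (hG : Continuous G) (hG0 : ∀ u, G u ≠ 0)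
    {ρ : ℝ} (hρ : 0 < ρ) (h : ∀ u : ℂ, ‖u‖ = 1 → ‖G u - ρ * u‖ < ρ) : False := by
  obtain ⟨l, ⟨-, hl⟩, -⟩ := Complex.isCoveringMapOn_exp.existsUnique_continuousMap_lifts
    (⟨G, hG⟩ : C(ℂ, ℂ)) (a₀ := 0) (e₀ := Complex.log (G 0)) (Complex.exp_log (hG0 0)) hG0
  have hl' (u : ℂ) : Complex.exp (l u) = G u := congrFun hl u
  let e : ℝ → ℂ := fun θ => Complex.exp (θ * Complex.I)
  have he : Continuous e := by fun_prop
  have he1 (θ : ℝ) : ‖e θ‖ = 1 := Complex.norm_exp_ofReal_mul_I θ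
  have he0 (θ : ℝ) : e θ ≠ 0 := Complex.exp_ne_zero _
  have hρ' : (ρ : ℂ) ≠ 0 := Complex.ofReal_ne_zero.2 hρ.ne'
  have hslit (θ : ℝ) : G (e θ) / (ρ * e θ) ∈ Complex.slitPlane := by
    have h1 : ‖G (e θ) / (ρ * e θ) - 1‖ < 1 := by
      have h2 : G (e θ) / (ρ * e θ) - 1 = (G (e θ) - ρ * e θ) / (ρ * e θ) := by
        rw [sub_div, div_self (mul_ne_zero hρ' (he0 θ))]
      rw [h2, norm_div, norm_mul, he1, mul_one, Complex.norm_real, Real.norm_of_nonneg hρ.le,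
        div_lt_one hρ]
      exact h _ (he1 θ)
    have := Complex.mem_slitPlane_of_norm_lt_one h1
    simpa using this
  let m : ℝ → ℂ := fun θ => l (e θ) - Complex.log (G (e θ) / (ρ * e θ))
  have hm : Continuous m := by
    refine (l.continuous.comp he).sub (Continuous.clog ?_ hslit)
    exact (hG.comp he).div (continuous_const.mul he) fun θ => mul_ne_zero hρ' (he0 θ)
  have hme (θ : ℝ) : Complex.exp (m θ) = ρ * e θ := by
    have h1 := hG0 (e θ)
    have h2 := he0 θ
    simp only [m]
    rw [Complex.exp_sub, hl', Complex.exp_log (Complex.slitPlane_ne_zero (hslit θ))]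
    field_simp
  have heq : m = fun θ : ℝ => m 0 + θ * Complex.I := by
    refine Complex.isCoveringMap_exp.eq_of_comp_eq hm (by fun_prop) ?_ 0 (by simp)
    ext θ
    have : e 0 = 1 := by simp [e]
    simp only [Function.comp_apply]
    rw [hme, Complex.exp_add, hme, this, mul_one]
  have h1 := congrFun heq (2 * Real.pi)
  have h2 : e (2 * Real.pi) = e 0 := by simp [e, Complex.exp_two_pi_mul_I]
  have h3 : m (2 * Real.pi) = m 0 := by simp only [m, h2]
  rw [h3] at h1
  have h4 : ((2 * Real.pi : ℝ) : ℂ) * Complex.I = 0 := by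
    linear_combination -h1
  simp [Real.pi_ne_zero] at h4

namespace UpperHalfPlane

open scoped ComplexConjugate

/-- The coordinate centered at `y` which maps the hyperbolic plane to the unit disk. -/
def diskCoord (y x : ℍ) : ℂ := ((x : ℂ) - y) / (x - conj (y : ℂ))

theorem sub_conj_ne_zero (x y : ℍ) : (x : ℂ) - conj (y : ℂ) ≠ 0 := by
  intro h
  have := congrArg Complex.im h
  have hx := x.im_pos
  have hy := y.im_pos
  simp at this
  linarith

theorem continuous_diskCoord (y : ℍ) : Continuous (diskCoord y) :=
  Continuous.div (by fun_prop) (by fun_prop) fun x => sub_conj_ne_zero x y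

theorem diskCoord_eq_zero {x y : ℍ} : diskCoord y x = 0 ↔ x = y := by
  rw [diskCoord, div_eq_zero_iff, or_iff_left (sub_conj_ne_zero x y), sub_eq_zero,
    UpperHalfPlane.ext_iff]

theorem one_sub_normSq_diskCoord (y x : ℍ) : 1 - Complex.normSq (diskCoord y x) =
    4 * x.im * y.im / Complex.normSq (x - conj (y : ℂ)) := by
  have h : Complex.normSq (x - conj (y : ℂ)) ≠ 0 := by simpa using sub_conj_ne_zero x y
  rw [diskCoord, map_div₀, one_sub_div h]
  congr 1
  simp [Complex.normSq_apply]
  ring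

/-- A bounded hyperbolic displacement becomes small in the Euclidean sense near the boundary of the
disk. -/
theorem normSq_diskCoord_sub (y x w : ℍ) : Complex.normSq (diskCoord y x - diskCoord y w) =
    Real.sinh (dist x w / 2) ^ 2 * (1 - Complex.normSq (diskCoord y x)) *
      (1 - Complex.normSq (diskCoord y w)) := by
  have h1 := sub_conj_ne_zero x y
  have h2 := sub_conj_ne_zero w y
  have h1' : Complex.normSq (x - conj (y : ℂ)) ≠ 0 := by simpa using h1
  have h2' : Complex.normSq (w - conj (y : ℂ)) ≠ 0 := by simpa using h2
  have hx := x.im_pos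
  have hw := w.im_pos
  have e : diskCoord y x - diskCoord y w =
      ((x : ℂ) - w) * (y - conj (y : ℂ)) / ((x - conj (y : ℂ)) * (w - conj (y : ℂ))) := by
    rw [diskCoord, diskCoord]
    field_simp
    ring
  have e2 : Complex.normSq (y - conj (y : ℂ)) = 4 * y.im ^ 2 := by
    simp [Complex.normSq_apply]; ring
  rw [one_sub_normSq_diskCoord, one_sub_normSq_diskCoord, e, map_div₀, map_mul, map_mul, e2,
    sinh_half_dist, div_pow, mul_pow, Real.sq_sqrt (by positivity), Complex.dist_eq,
    Complex.sq_norm]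
  field_simp
  norm_num

theorem exists_diskCoord_eq {X : Type*} [TopologicalSpace X] (y : ℍ) {u : X → ℂ}
    (hu : Continuous u) (hu1 : ∀ t, ‖u t‖ < 1) :
    ∃ x : X → ℍ, Continuous x ∧ ∀ t, diskCoord y (x t) = u t := by
  have h1 (t : X) : 1 - u t ≠ 0 := by
    intro h
    have := hu1 t
    rw [← sub_eq_zero.1 h] at this
    simp at this
  have him (t : X) : 0 < ((y - u t * conj (y : ℂ)) / (1 - u t)).im := by
    have e : ((y - u t * conj (y : ℂ)) / (1 - u t)).im =
        y.im * (1 - Complex.normSq (u t)) / Complex.normSq (1 - u t) := by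
      rw [Complex.div_im, div_sub_div_same]
      congr 1
      simp [Complex.normSq_apply]
      ring
    rw [e]
    have h2 : Complex.normSq (u t) < 1 := by
      rw [← Complex.sq_norm]
      exact pow_lt_one₀ (norm_nonneg _) (hu1 t) two_ne_zero
    exact div_pos (mul_pos y.im_pos (by linarith)) (Complex.normSq_pos.2 (h1 t))
  refine ⟨fun t => ⟨_, him t⟩, ?_, fun t => ?_⟩
  · exact Continuous.upperHalfPlaneMk (Continuous.div (by fun_prop) (by fun_prop) h1) him
  · have h2 := h1 t
    have h3 : (y : ℂ) - conj (y : ℂ) ≠ 0 := sub_conj_ne_zero y y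
    rw [diskCoord, coe_mk, div_eq_iff]
    · field_simp
      ring
    · have e : (y - u t * conj (y : ℂ)) / (1 - u t) - conj (y : ℂ) =
          (y - conj (y : ℂ)) / (1 - u t) := by
        field_simp
        ring
      rw [e]
      exact div_ne_zero h3 h2

/-- If `y` were missed, `f` read in the disk centered at `y` would never vanish, although on a
circle of radius `ρ` close to one it moves points by less than `ρ`. -/
theorem surjective_of_dist_le {f : ℍ → ℍ} (hf : Continuous f) {C : ℝ}
    (hC : ∀ x, dist (f x) x ≤ C) : Function.Surjective f := by
  intro y
  by_contra! hy
  set K := Real.sinh (C / 2) ^ 2 with hK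
  have hK0 : 0 ≤ K := sq_nonneg _
  have hC0 : 0 ≤ C := dist_nonneg.trans (hC y)
  -- Chosen so that `K (1 - ρ²) = K / (2K + 2) < 1/2 ≤ ρ²`.
  set ρ := √((2 * K + 1) / (2 * K + 2)) with hρ
  have hρ0 : 0 < ρ := Real.sqrt_pos.2 (by positivity)
  have hρ2 : ρ ^ 2 = (2 * K + 1) / (2 * K + 2) := Real.sq_sqrt (by positivity)
  have hρ1 : ρ < 1 := by
    rw [hρ, Real.sqrt_lt' one_pos, one_pow, div_lt_one (by positivity)]
    linarith
  let u : ℂ → ℂ := fun t => ρ * t / (max 1 ‖t‖ : ℝ)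
  have hmax (t : ℂ) : 0 < max 1 ‖t‖ := lt_max_of_lt_left one_pos
  have hu : Continuous u := by
    refine Continuous.div (by fun_prop) ?_ fun t => Complex.ofReal_ne_zero.2 (hmax t).ne'
    exact Complex.continuous_ofReal.comp (continuous_const.max continuous_norm)
  have hu1 (t : ℂ) : ‖u t‖ < 1 := by
    simp only [u]
    rw [norm_div, norm_mul, Complex.norm_real, Complex.norm_real, Real.norm_of_nonneg hρ0.le,
      Real.norm_of_nonneg (hmax t).le, div_lt_one (hmax t)]
    rcases eq_or_ne t 0 with rfl | ht
    · simp
    · exact (mul_lt_of_lt_one_left (norm_pos_iff.2 ht) hρ1).trans_le (le_max_right _ _)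
  obtain ⟨x, hx, hxu⟩ := exists_diskCoord_eq y hu hu1
  refine false_of_norm_sub_lt_on_circle (G := fun t => diskCoord y (f (x t)))
    ((continuous_diskCoord y).comp (hf.comp hx))
    (fun t h => hy _ (diskCoord_eq_zero.1 h)) hρ0 fun t ht => ?_
  have h1 : diskCoord y (x t) = ρ * t := by rw [hxu]; simp [u, ht]
  have h2 := normSq_diskCoord_sub y (f (x t)) (x t)
  have h3 : Complex.normSq (ρ * t : ℂ) = ρ ^ 2 := by
    rw [← Complex.sq_norm, norm_mul, ht, mul_one, Complex.norm_real, Real.norm_of_nonneg hρ0.le]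
  rw [h1, h3] at h2
  have h4 : Real.sinh (dist (f (x t)) (x t) / 2) ^ 2 ≤ K := by
    rw [hK]
    refine pow_le_pow_left₀ (Real.sinh_nonneg_iff.2 (by positivity)) (Real.sinh_le_sinh.2 ?_) 2
    linarith [hC (x t)]
  have h5 : 0 ≤ 1 - ρ ^ 2 := by nlinarith
  have h6 : 1 - Complex.normSq (diskCoord y (f (x t))) ≤ 1 := by
    linarith [Complex.normSq_nonneg (diskCoord y (f (x t)))]
  have h8 : 0 ≤ 1 - Complex.normSq (diskCoord y (f (x t))) := by
    rw [one_sub_normSq_diskCoord]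
    have h1 := (f (x t)).im_pos
    have h2 := y.im_pos
    exact div_nonneg (by positivity) (Complex.normSq_nonneg _)
  have h7 : K * (1 - ρ ^ 2) < ρ ^ 2 := by
    rw [hρ2, ← sub_pos]
    have : (2 * K + 1) / (2 * K + 2) - K * (1 - (2 * K + 1) / (2 * K + 2)) =
      (K + 1) / (2 * K + 2) := by field_simp; ring
    rw [this]; positivity
  rw [← sq_lt_sq₀ (norm_nonneg _) hρ0.le, Complex.sq_norm, h2]
  calc _ ≤ K * 1 * (1 - ρ ^ 2) := by gcongr
    _ < ρ ^ 2 := by rw [mul_one]; exact h7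

/-! ### Hyperbolic barycenters -/

/-- In the hyperboloid model, `q` lies on the ray through the vector which represents the function
`S` on the hyperbolic plane. -/
def IsBarycenter (S : ℍ → ℝ) (q : ℍ) : Prop :=
  ∃ r > 0, ∀ v, r * Real.cosh (dist q v) = S v

theorem IsBarycenter.unique {S : ℍ → ℝ} {p q : ℍ} (hp : IsBarycenter S p)
    (hq : IsBarycenter S q) : p = q := by
  obtain ⟨r, hr, h⟩ := hp
  obtain ⟨s, hs, h'⟩ := hq
  have e1 := (h p).trans (h' p).symm
  have e2 := (h q).trans (h' q).symm
  rw [dist_self, Real.cosh_zero, dist_comm q p] at *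
  have h1 : Real.cosh (dist p q) = 1 := by
    have := Real.one_le_cosh (dist p q)
    nlinarith
  rw [← dist_eq_zero]
  by_contra h0
  exact (Real.one_lt_cosh.2 h0).ne' h1

theorem IsBarycenter.smul {G : Type*} [Group G] [MulAction G ℍ] [IsIsometricSMul G ℍ] (g : G)
    {S : ℍ → ℝ} {q : ℍ} (h : IsBarycenter S q) :
    IsBarycenter (fun v => S (g⁻¹ • v)) (g • q) := by
  obtain ⟨r, hr, h⟩ := h
  refine ⟨r, hr, fun v => ?_⟩
  simp only [← h (g⁻¹ • v), ← dist_smul g q, smul_inv_smul]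

/-- A nonnegative, nonzero combination of hyperboloid vectors has coordinates `(A, B, C)`. By
Cauchy–Schwarz `A C - B² > 0`, so the vector is timelike and its ray meets the hyperboloid in the
point `(B + i √(A C - B²)) / A`. -/
theorem exists_continuous_isBarycenter {X ι : Type*} [TopologicalSpace X] [Fintype ι]
    (w : ι → ℍ) {k : X → ι → ℝ} (hk : Continuous k) (hk0 : ∀ t i, 0 ≤ k t i)
    (hk1 : ∀ t, 0 < ∑ i, k t i) :
    ∃ F : X → ℍ, Continuous F ∧
      ∀ t, IsBarycenter (fun v => ∑ i, k t i * Real.cosh (dist (w i) v)) (F t) := by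
  let A : X → ℝ := fun t => ∑ i, k t i * (1 / (w i).im)
  let B : X → ℝ := fun t => ∑ i, k t i * ((w i).re / (w i).im)
  let C : X → ℝ := fun t => ∑ i, k t i * (((w i).re ^ 2 + (w i).im ^ 2) / (w i).im)
  have hki (i : ι) : Continuous fun t => k t i := (continuous_apply i).comp hk
  have hA : Continuous A := continuous_finsetSum _ fun i _ => (hki i).mul continuous_const
  have hB : Continuous B := continuous_finsetSum _ fun i _ => (hki i).mul continuous_const
  have hC : Continuous C := continuous_finsetSum _ fun i _ => (hki i).mul continuous_const
  have hex (t : X) : ∃ i, 0 < k t i := by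
    by_contra! h
    exact (hk1 t).not_ge (Finset.sum_nonpos fun i _ => h i)
  have hpos (t : X) (a : ι → ℝ) (ha : ∀ i, 0 < a i) : 0 < ∑ i, k t i * a i := by
    obtain ⟨i, hi⟩ := hex t
    exact Finset.sum_pos' (fun j _ => mul_nonneg (hk0 t j) (ha j).le)
      ⟨i, Finset.mem_univ i, mul_pos hi (ha i)⟩
  have hA0 (t : X) : 0 < A t := hpos t _ fun i => one_div_pos.2 (w i).im_pos
  have hD0 (t : X) : 0 < A t * C t - B t ^ 2 := by
    have h1 : B t ^ 2 ≤ A t * ∑ i, k t i * ((w i).re ^ 2 / (w i).im) := by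
      refine Finset.sum_sq_le_sum_mul_sum_of_sq_le_mul _
        (fun i _ => mul_nonneg (hk0 t i) (one_div_pos.2 (w i).im_pos).le)
        (fun i _ => mul_nonneg (hk0 t i) (div_nonneg (sq_nonneg _) (w i).im_pos.le))
        fun i _ => le_of_eq ?_
      have := (w i).im_pos
      field_simp
    have h2 : C t = ∑ i, k t i * ((w i).re ^ 2 / (w i).im) + ∑ i, k t i * (w i).im := by
      rw [← Finset.sum_add_distrib]
      refine Finset.sum_congr rfl fun i _ => ?_
      have := (w i).im_pos
      field_simp
    have h3 := mul_pos (hA0 t) (hpos t _ fun i => (w i).im_pos)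
    rw [h2]
    nlinarith
  have him (t : X) : 0 < (⟨B t / A t, √(A t * C t - B t ^ 2) / A t⟩ : ℂ).im :=
    div_pos (Real.sqrt_pos.2 (hD0 t)) (hA0 t)
  refine ⟨fun t => ⟨_, him t⟩, ?_, fun t => ?_⟩
  · refine Continuous.upperHalfPlaneMk (Complex.equivRealProdCLM.symm.continuous.comp
      (f := fun t => (B t / A t, √(A t * C t - B t ^ 2) / A t)) ?_) him
    exact (hB.div hA fun t => (hA0 t).ne').prodMk
      (((hA.mul hC).sub (hB.pow 2)).sqrt.div hA fun t => (hA0 t).ne')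
  · have hr := Real.sqrt_pos.2 (hD0 t)
    refine ⟨√(A t * C t - B t ^ 2), hr, fun v => ?_⟩
    have hv := v.im_pos
    have hA' := hA0 t
    apply mul_left_cancel₀ (mul_pos two_pos hv).ne'
    have e : 2 * v.im * ∑ i, k t i * Real.cosh (dist (w i) v) =
        C t - 2 * B t * v.re + A t * (v.re ^ 2 + v.im ^ 2) := by
      rw [Finset.mul_sum]
      simp only [mul_left_comm (2 * v.im), two_mul_im_mul_cosh_dist]
      simp only [A, B, C, Finset.mul_sum, Finset.sum_mul, ← Finset.sum_sub_distrib,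
        ← Finset.sum_add_distrib]
      exact Finset.sum_congr rfl fun i _ => by ring
    rw [mul_left_comm, two_mul_im_mul_cosh_dist, e]
    simp only [mk_re, mk_im]
    have h2 := Real.sq_sqrt (hD0 t).le
    set r := √(A t * C t - B t ^ 2)
    field_simp
    linear_combination h2

end UpperHalfPlane

/-! ### Barycentric weights on a polygon -/

theorem polygonEdge_eq_exp (m j : ℕ) (t : ℝ) :
    polygonEdge m j t = Complex.exp ((2 * Real.pi * ((j + t) / m) : ℝ) * Complex.I) := by
  rw [polygonEdge]
  congr 1
  push_cast
  ring

theorem norm_polygonEdge (m j : ℕ) (t : ℝ) : ‖polygonEdge m j t‖ = 1 := by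
  rw [polygonEdge_eq_exp, Complex.norm_exp_ofReal_mul_I]

theorem continuous_polygonEdge (m j : ℕ) : Continuous (polygonEdge m j) := by
  unfold polygonEdge
  fun_prop

theorem polygonEdge_one (m j : ℕ) : polygonEdge m j 1 = polygonEdge m (j + 1) 0 := by
  simp [polygonEdge]

theorem polygonEdge_self {m : ℕ} (hm : 0 < m) : polygonEdge m m 0 = polygonEdge m 0 0 := by
  have : (m : ℂ) ≠ 0 := Nat.cast_ne_zero.2 hm.ne'
  simp [polygonEdge, this, Complex.exp_two_pi_mul_I]

theorem exists_eq_smul_polygonEdge {m : ℕ} (hm : 0 < m) (z : ℂ) :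
    ∃ j < m, ∃ t ∈ Set.Icc (0 : ℝ) 1, z = ‖z‖ * polygonEdge m j t := by
  have hm' : (0 : ℝ) < m := Nat.cast_pos.2 hm
  obtain ⟨s, hs0, hs1, hs⟩ : ∃ s : ℝ, 0 ≤ s ∧ s < m ∧
      Complex.exp ((2 * Real.pi * (s / m) : ℝ) * Complex.I) = Complex.exp (z.arg * Complex.I) := by
    have hpi := Real.pi_pos
    have h1 := Complex.neg_pi_lt_arg z
    have h2 := Complex.arg_le_pi z
    rcases le_or_gt 0 z.arg with h | h
    · refine ⟨m * (z.arg / (2 * Real.pi)), by positivity, ?_, ?_⟩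
      · rw [mul_lt_iff_lt_one_right hm', div_lt_one (by positivity)]
        linarith
      · congr 3; field_simp
    · refine ⟨m * ((z.arg + 2 * Real.pi) / (2 * Real.pi)), ?_, ?_, ?_⟩
      · have : 0 ≤ z.arg + 2 * Real.pi := by linarith
        positivity
      · rw [mul_lt_iff_lt_one_right hm', div_lt_one (by positivity)]
        linarith
      · have e : 2 * Real.pi * (m * ((z.arg + 2 * Real.pi) / (2 * Real.pi)) / m) =
            z.arg + 2 * Real.pi := by field_simp
        rw [e]
        push_cast
        rw [add_mul, Complex.exp_add, Complex.exp_two_pi_mul_I, mul_one]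
  refine ⟨⌊s⌋₊, (Nat.floor_lt hs0).2 hs1, s - ⌊s⌋₊, ⟨sub_nonneg.2 (Nat.floor_le hs0), ?_⟩, ?_⟩
  · linarith [Nat.lt_floor_add_one s]
  · rw [polygonEdge_eq_exp, add_sub_cancel, hs, Complex.norm_mul_exp_arg_mul_I]

theorem exists_arccos_cos_eq (x : ℝ) :
    ∃ n : ℤ, Real.arccos (Real.cos x) = |x - n * (2 * Real.pi)| := by
  have hpi := Real.pi_pos
  refine ⟨round (x / (2 * Real.pi)), ?_⟩
  have h := abs_sub_round (x / (2 * Real.pi))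
  have h1 : |x - round (x / (2 * Real.pi)) * (2 * Real.pi)| ≤ Real.pi := by
    have e : x - round (x / (2 * Real.pi)) * (2 * Real.pi) =
        (x / (2 * Real.pi) - round (x / (2 * Real.pi))) * (2 * Real.pi) := by field_simp
    rw [e, abs_mul, abs_of_pos (by positivity : 0 < 2 * Real.pi)]
    nlinarith
  rw [← Real.cos_sub_int_mul_two_pi x (round (x / (2 * Real.pi))), ← Real.cos_abs,
    Real.arccos_cos (abs_nonneg _) h1]

/-- The function on the plane which is homogeneous of degree one, equal to one at the `l`-th vertex
of the `m`-gon, supported on the two sectors at this vertex, and linear in the angle there. -/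
def tent (m l : ℕ) (z : ℂ) : ℝ :=
  max 0 (‖z‖ * (1 - m / (2 * Real.pi) *
    Real.arccos ((z * starRingEnd ℂ (polygonEdge m l 0)).re / ‖z‖)))

theorem tent_nonneg (m l : ℕ) (z : ℂ) : 0 ≤ tent m l z := le_max_left _ _

theorem tent_le_norm (m l : ℕ) (z : ℂ) : tent m l z ≤ ‖z‖ := by
  refine max_le (norm_nonneg z) (mul_le_of_le_one_right (norm_nonneg z) ?_)
  have : 0 ≤ m / (2 * Real.pi) *
      Real.arccos ((z * starRingEnd ℂ (polygonEdge m l 0)).re / ‖z‖) :=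
    mul_nonneg (by positivity) (Real.arccos_nonneg _)
  linarith

theorem continuous_tent (m l : ℕ) : Continuous (tent m l) := by
  rw [continuous_iff_continuousAt]
  intro z
  rcases eq_or_ne z 0 with rfl | hz
  · have h0 : tent m l 0 = 0 := by simp [tent]
    rw [ContinuousAt, h0]
    refine squeeze_zero (tent_nonneg m l) (tent_le_norm m l) ?_
    simpa using (continuous_norm (E := ℂ)).tendsto 0
  · have hz' : ‖z‖ ≠ 0 := norm_ne_zero_iff.2 hz
    have h1 : ContinuousAt (fun z : ℂ =>
        (z * starRingEnd ℂ (polygonEdge m l 0)).re / ‖z‖) z :=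
      ContinuousAt.div (by fun_prop) (by fun_prop) hz'
    have h2 := Real.continuous_arccos.continuousAt.comp h1
    exact continuousAt_const.max (continuousAt_id.norm.mul
      (continuousAt_const.sub (continuousAt_const.mul h2)))

theorem tent_smul_polygonEdge {m l j : ℕ} {r t : ℝ} (hr : 0 ≤ r) :
    tent m l (r * polygonEdge m j t) = max 0 (r * (1 - m / (2 * Real.pi) *
      Real.arccos (Real.cos (2 * Real.pi * ((j + t - l) / m))))) := by
  rcases hr.eq_or_lt with rfl | hr
  · simp [tent]
  · have h1 : ‖(r : ℂ) * polygonEdge m j t‖ = r := by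
      rw [norm_mul, norm_polygonEdge, mul_one, Complex.norm_real, Real.norm_of_nonneg hr.le]
    have h2 : (r * polygonEdge m j t * starRingEnd ℂ (polygonEdge m l 0)).re / r =
        Real.cos (2 * Real.pi * ((j + t - l) / m)) := by
      have e : r * polygonEdge m j t * starRingEnd ℂ (polygonEdge m l 0) =
          r * Complex.exp ((2 * Real.pi * ((j + t - l) / m) : ℝ) * Complex.I) := by
        rw [polygonEdge_eq_exp, polygonEdge_eq_exp, ← Complex.exp_conj, mul_assoc,
          ← Complex.exp_add]
        congr 2
        simp only [map_mul, Complex.conj_ofReal, Complex.conj_I]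
        push_cast
        ring
      rw [e, Complex.re_ofReal_mul, Complex.exp_ofReal_mul_I_re, mul_div_cancel_left₀ _ hr.ne']
    rw [tent, h1, h2]

theorem tent_eq_of_eq {m l j : ℕ} (hm : 2 ≤ m) {r t : ℝ} (hr : 0 ≤ r) {s : ℝ} (hs0 : 0 ≤ s)
    (hs1 : s ≤ 1) (n : ℤ) (hs : j + t - l = n * m + s ∨ j + t - l = n * m - s) :
    tent m l (r * polygonEdge m j t) = r * (1 - s) := by
  have hm0 : (0 : ℝ) < m := by positivity
  have hm' : (2 : ℝ) ≤ m := by exact_mod_cast hm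
  have hpi := Real.pi_pos
  have hc : Real.cos (2 * Real.pi * ((j + t - l) / m)) = Real.cos (2 * Real.pi * (s / m)) := by
    rcases hs with h | h
    · rw [h, ← Real.cos_add_int_mul_two_pi (2 * Real.pi * (s / m)) n]
      congr 1; field_simp; ring
    · rw [h, ← Real.cos_neg (2 * Real.pi * (s / m)),
        ← Real.cos_add_int_mul_two_pi (-(2 * Real.pi * (s / m))) n]
      congr 1; field_simp; ring
  have hle : 2 * Real.pi * (s / m) ≤ Real.pi := by
    have : s / m ≤ 1 / 2 := by rw [div_le_div_iff₀ hm0 two_pos]; linarith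
    nlinarith
  rw [tent_smul_polygonEdge hr, hc, Real.arccos_cos (by positivity) hle]
  have e : (m : ℝ) / (2 * Real.pi) * (2 * Real.pi * (s / m)) = s := by field_simp
  rw [e, max_eq_right (mul_nonneg hr (by linarith))]

theorem tent_eq_zero {m l j : ℕ} (hm : 2 ≤ m) (hl : l < m) (hj : j < m) (hlj : l ≠ j)
    (hlj' : l ≠ (j + 1) % m) {r t : ℝ} (hr : 0 ≤ r) (ht : t ∈ Set.Icc (0 : ℝ) 1) :
    tent m l (r * polygonEdge m j t) = 0 := by
  have hm0 : (0 : ℝ) < m := by positivity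
  have hpi := Real.pi_pos
  rw [tent_smul_polygonEdge hr]
  obtain ⟨n, hn⟩ := exists_arccos_cos_eq (2 * Real.pi * ((j + t - l) / m))
  have e : 2 * Real.pi * ((j + t - l) / m) - n * (2 * Real.pi) =
      2 * Real.pi / m * (((j - l - n * m : ℤ) : ℝ) + t) := by
    push_cast; field_simp; ring
  rw [hn, e, abs_mul, abs_of_pos (by positivity : 0 < 2 * Real.pi / m)]
  have e' : (m : ℝ) / (2 * Real.pi) * (2 * Real.pi / m * |((j - l - n * m : ℤ) : ℝ) + t|) =
    |((j - l - n * m : ℤ) : ℝ) + t| := by field_simp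
  rw [e']
  apply max_eq_left
  refine mul_nonpos_of_nonneg_of_nonpos hr ?_
  rw [sub_nonpos]
  -- The offset of edge `j` from vertex `l` modulo `m`. The values `0` and `-1` occur only when `l`
  -- is an endpoint of the edge; otherwise `|i + t| ≥ 1`, outside the support.
  set i : ℤ := j - l - n * m with hi
  have hi0 : i ≠ 0 := by
    intro h0
    have h1 : ((j : ℤ) - l) = m * n := by linarith
    have h2 : (j : ℤ) - l = 0 := Int.eq_zero_of_abs_lt_dvd ⟨n, h1⟩ (by rw [abs_lt]; omega)
    omega
  have hi1 : i ≠ -1 := by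
    intro h0
    have h1 : ((j : ℤ) + 1 - l) = m * n := by linarith
    apply hlj'
    have h2 : (j + 1 : ℕ) ≡ l [MOD m] := by
      rw [← Int.natCast_modEq_iff, Int.modEq_comm, Int.modEq_iff_dvd]
      exact ⟨n, by push_cast; exact h1⟩
    rw [h2, Nat.mod_eq_of_lt hl]
  rcases lt_or_ge i 0 with h | h
  · have : (i : ℝ) ≤ -2 := by exact_mod_cast (by omega : i ≤ -2)
    rw [le_abs]; right; linarith [ht.2]
  · have : (1 : ℝ) ≤ i := by exact_mod_cast (by omega : 1 ≤ i)
    rw [le_abs]; left; linarith [ht.1]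

/-- Weights on the unit disk, viewed as an `m`-gon which is the cone, with apex at the zeroth
vertex, over its boundary. -/
def polygonWeight (m : ℕ) (z : ℂ) (l : Fin m) : ℝ :=
  tent m l z + if (l : ℕ) = 0 then 1 - ‖z‖ else 0

theorem continuous_polygonWeight (m : ℕ) : Continuous (polygonWeight m) := by
  refine continuous_pi fun l => (continuous_tent m l).add ?_
  split_ifs <;> fun_prop

theorem polygonWeight_nonneg {m : ℕ} {z : ℂ} (hz : ‖z‖ ≤ 1) (l : Fin m) :
    0 ≤ polygonWeight m z l := by
  refine add_nonneg (tent_nonneg _ _ _) ?_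
  split_ifs <;> linarith

/-- At most three weights matter in the `j`-th sector, those of the vertices `0`, `j`, `j + 1`; on
the boundary (`r = 1`) only the two ends of the edge remain. Hence barycenters send sectors into the
triangles of a fan, and edges to geodesics depending on their endpoints alone. -/
theorem sum_polygonWeight {m j : ℕ} (hm : 2 ≤ m) (hj : j < m) {r t : ℝ} (hr : 0 ≤ r)
    (ht : t ∈ Set.Icc (0 : ℝ) 1) (a : ℕ → ℝ) (ha : a m = a 0) :
    ∑ l : Fin m, polygonWeight m (r * polygonEdge m j t) l * a l =
      (1 - r) * a 0 + r * ((1 - t) * a j + t * a (j + 1)) := by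
  have h1 : ‖(r : ℂ) * polygonEdge m j t‖ = r := by
    rw [norm_mul, norm_polygonEdge, mul_one, Complex.norm_real, Real.norm_of_nonneg hr]
  have hmod : a ((j + 1) % m) = a (j + 1) := by
    rcases (Nat.succ_le_of_lt hj).eq_or_lt with h | h
    · rw [show j + 1 = m from h, Nat.mod_self, ha]
    · rw [Nat.mod_eq_of_lt h]
  have hne : j ≠ (j + 1) % m := by
    rcases (Nat.succ_le_of_lt hj).eq_or_lt with h | h
    · rw [show j + 1 = m from h, Nat.mod_self]; omega
    · rw [Nat.mod_eq_of_lt h]; omega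
  have hA : ∑ l : Fin m, tent m l (r * polygonEdge m j t) * a l =
      r * (1 - t) * a j + r * t * a (j + 1) := by
    rw [Fin.sum_univ_eq_sum_range (fun l => tent m l (r * polygonEdge m j t) * a l),
      ← Finset.sum_subset (s₁ := {j, (j + 1) % m}), Finset.sum_pair hne, hmod]
    · congr 2
      · exact tent_eq_of_eq hm hr ht.1 ht.2 0 (Or.inl (by push_cast; ring))
      · rw [tent_eq_of_eq (s := 1 - t) hm hr (by linarith [ht.2]) (by linarith [ht.1])
          (((j + 1) / m : ℕ) : ℤ)]
        · ring
        · right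
          have := Nat.div_add_mod (j + 1) m
          have h2 : (m : ℝ) * ((j + 1) / m : ℕ) + ((j + 1) % m : ℕ) = j + 1 := by
            exact_mod_cast this
          rw [Int.cast_natCast]
          linarith
    · intro l hl
      simp only [Finset.mem_insert, Finset.mem_singleton] at hl
      rw [Finset.mem_range]
      rcases hl with rfl | rfl
      · exact hj
      · exact Nat.mod_lt _ (by omega)
    · intro l hl hl'
      simp only [Finset.mem_insert, Finset.mem_singleton, not_or] at hl'
      rw [tent_eq_zero hm (Finset.mem_range.1 hl) hj hl'.1 hl'.2 hr ht, zero_mul]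
  have hB : ∑ l : Fin m, (if (l : ℕ) = 0 then 1 - r else 0) * a l = (1 - r) * a 0 := by
    rw [Fin.sum_univ_eq_sum_range (fun l => (if l = 0 then 1 - r else 0) * a l)]
    simp only [ite_mul, zero_mul]
    rw [Finset.sum_ite_eq' _ 0 (fun l => (1 - r) * a l), if_pos (Finset.mem_range.2 (by omega))]
  simp only [polygonWeight, add_mul, Finset.sum_add_distrib, h1]
  rw [hA, hB]
  ring

theorem sum_polygonWeight_eq_one {m : ℕ} (hm : 2 ≤ m) (z : ℂ) :
    ∑ l : Fin m, polygonWeight m z l = 1 := by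
  obtain ⟨j, hj, t, ht, hz⟩ := exists_eq_smul_polygonEdge (by omega : 0 < m) z
  have := sum_polygonWeight hm hj (norm_nonneg z) ht (fun _ => 1) rfl
  rw [← hz] at this
  simp only [mul_one] at this
  rw [this]; ring

/-! ### The covering projection -/

namespace OrbitSpace

variable {G X : Type*} [Group G] [MulAction G X]

theorem proj_eq_proj_iff {x y : X} : proj G x = proj G y ↔ ∃ g : G, g • y = x :=
  Quotient.eq''

theorem proj_smul (g : G) (x : X) : proj G (g • x) = proj G x :=
  proj_eq_proj_iff.2 ⟨g, rfl⟩

theorem proj_surjective : Function.Surjective (proj G : X → OrbitSpace G X) :=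
  Quotient.mk_surjective

variable [TopologicalSpace X] [ContinuousConstSMul G X] [ProperlyDiscontinuousSMul G X]
  [LocallyCompactSpace X] [T2Space X] [IsCancelSMul G X]

theorem isQuotientCoveringMap_proj : IsQuotientCoveringMap (proj G : X → OrbitSpace G X) G :=
  isQuotientCoveringMap_quotientMk_of_properlyDiscontinuousSMul

theorem isCoveringMap_proj : IsCoveringMap (proj G : X → OrbitSpace G X) :=
  isQuotientCoveringMap_proj.isCoveringMap

/-- Two lifts of one map from a connected space differ by a single deck transformation: uniqueness
of lifts, applied to `b` and `g • a`. -/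
theorem eq_smul_of_proj_comp_eq {Y : Type*} [TopologicalSpace Y] [PreconnectedSpace Y]
    {a b : Y → X} (ha : Continuous a) (hb : Continuous b)
    (hab : ∀ y, proj G (b y) = proj G (a y)) {g : G} {y₀ : Y} (h : b y₀ = g • a y₀) (y : Y) :
    b y = g • a y := by
  refine congrFun ((isCoveringMap_proj (G := G)).eq_of_comp_eq hb (ha.const_smul g) ?_ y₀ h) y
  ext z
  simp only [Function.comp_apply, Pi.smul_apply, proj_smul, hab]

end OrbitSpace

/-! ### Straightening a polygon -/

section Polygon

variable {Δ : Type*} [Group Δ] [MulAction Δ ℍ] [IsIsometricSMul Δ ℍ]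
  [ProperlyDiscontinuousSMul Δ ℍ]

/-- The translates of the compact image of `p` form a locally finite closed cover. On the image
itself `f` is continuous because `p` is a quotient map onto it; equivariance carries this to the
translates. -/
theorem continuous_of_continuous_comp_of_equivariant {P Y : Type*} [TopologicalSpace P]
    [CompactSpace P] [TopologicalSpace Y] [MulAction Δ Y] [ContinuousConstSMul Δ Y]
    {p : P → ℍ} (hp : Continuous p) (hcov : ∀ x, ∃ δ : Δ, ∃ z, x = δ • p z)
    {f : ℍ → Y} (hf : Continuous (f ∘ p)) (hequiv : ∀ (δ : Δ) x, f (δ • x) = δ • f x) :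
    Continuous f := by
  have hK : IsCompact (Set.range p) := isCompact_range hp
  have hlf : LocallyFinite fun δ : Δ => δ • Set.range p := by
    intro x
    obtain ⟨L, hL, hxL⟩ := exists_compact_mem_nhds x
    exact ⟨L, hxL, (ProperlyDiscontinuousSMul.finite_disjoint_inter_image hK hL).subset
      fun δ hδ => hδ⟩
  refine hlf.continuous ?_ (fun δ => (hK.isClosed).smul δ) fun δ => ?_
  · rw [Set.eq_univ_iff_forall]
    intro x
    obtain ⟨δ, z, rfl⟩ := hcov x
    exact Set.mem_iUnion.2 ⟨δ, Set.smul_mem_smul_set ⟨z, rfl⟩⟩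
  · have hquot : Topology.IsQuotientMap (Set.rangeFactorization p) :=
      (hp.subtype_mk _).isClosedMap.isQuotientMap (hp.subtype_mk _)
        Set.rangeFactorization_surjective
    have h1 : ContinuousOn f (Set.range p) := by
      rw [continuousOn_iff_continuous_domRestrict, hquot.continuous_iff]
      exact hf
    have h2 : f = fun x => δ • f (δ⁻¹ • x) := by
      ext x
      rw [hequiv, smul_inv_smul]
    rw [h2]
    refine ContinuousOn.const_smul (h1.comp (continuous_const_smul δ⁻¹).continuousOn ?_) δ
    intro x hx
    rwa [← Set.mem_smul_set_iff_inv_smul_mem]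

variable [IsCancelSMul Δ ℍ]

/-- The closed unit disk. -/
abbrev UnitDisk : Type := Metric.closedBall (0 : ℂ) 1

/-- The point with parameter `t` on the `j`-th edge, as a point of the unit disk. -/
def edgePoint (m j : ℕ) (t : ℝ) : UnitDisk :=
  ⟨polygonEdge m j t, by simp [norm_polygonEdge]⟩

theorem continuous_edgePoint (m j : ℕ) : Continuous (edgePoint m j) :=
  (continuous_polygonEdge m j).subtype_mk _

theorem exists_lift_unitDisk {q : UnitDisk → OrbitSpace Δ ℍ} (hq : Continuous q) :
    ∃ p : UnitDisk → ℍ, Continuous p ∧ ∀ z, OrbitSpace.proj Δ (p z) = q z := by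
  -- Radial retraction, so that the lifting theorem can be applied on the simply connected plane.
  let r : ℂ → UnitDisk := fun z => ⟨((max 1 ‖z‖ : ℝ) : ℂ)⁻¹ * z, by
    have h : 0 < max 1 ‖z‖ := lt_max_of_lt_left one_pos
    rw [mem_closedBall_zero_iff, norm_mul, norm_inv, Complex.norm_real, Real.norm_of_nonneg h.le,
      inv_mul_le_iff₀ h, mul_one]
    exact le_max_right _ _⟩
  have hr : Continuous r := by
    refine Continuous.subtype_mk (Continuous.mul (Continuous.inv₀ ?_ fun z => ?_) continuous_id) _
    · exact Complex.continuous_ofReal.comp (continuous_const.max continuous_norm)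
    · exact Complex.ofReal_ne_zero.2 (lt_max_of_lt_left one_pos).ne'
  have hr1 (z : UnitDisk) : r z = z := by
    have h : ‖(z : ℂ)‖ ≤ 1 := mem_closedBall_zero_iff.1 z.2
    ext
    simp [r, h]
  obtain ⟨e₀, he₀⟩ := OrbitSpace.proj_surjective (q (r 0))
  obtain ⟨F, ⟨-, hF⟩, -⟩ := (OrbitSpace.isCoveringMap_proj (G := Δ)
    (X := ℍ)).existsUnique_continuousMap_lifts (⟨q ∘ r, hq.comp hr⟩ : C(ℂ, _)) 0 e₀ he₀
  refine ⟨fun z => F z, F.continuous.comp continuous_subtype_val, fun z => ?_⟩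
  have := congrFun hF (z : ℂ)
  simpa [hr1] using this

/-- The relation `R` identifies edges of the `m`-gon in pairs. -/
def IsEdgeGluing (m : ℕ) (R : UnitDisk → UnitDisk → Prop) : Prop :=
  ∀ x y, R x y → ∃ j < m, ∃ j' < m, ∃ t ∈ Set.Icc (0 : ℝ) 1,
    (x = edgePoint m j t ∧ y = edgePoint m j' t ∧
      ∀ s ∈ Set.Icc (0 : ℝ) 1, R (edgePoint m j s) (edgePoint m j' s)) ∨
    (x = edgePoint m j t ∧ y = edgePoint m j' (1 - t) ∧
      ∀ s ∈ Set.Icc (0 : ℝ) 1, R (edgePoint m j s) (edgePoint m j' (1 - s)))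

theorem smul_edge_eq {q : UnitDisk → OrbitSpace Δ ℍ} {p : UnitDisk → ℍ} (hp : Continuous p)
    (hpq : ∀ z, OrbitSpace.proj Δ (p z) = q z) {a b : ℝ → UnitDisk} (ha : Continuous a)
    (hb : Continuous b) (hab : ∀ s ∈ Set.Icc (0 : ℝ) 1, q (a s) = q (b s)) {t : ℝ}
    (ht : t ∈ Set.Icc (0 : ℝ) 1) {δ : Δ} (h : p (b t) = δ • p (a t)) :
    ∀ s ∈ Set.Icc (0 : ℝ) 1, p (b s) = δ • p (a s) := fun s hs =>
  OrbitSpace.eq_smul_of_proj_comp_eq (Y := unitInterval) (a := fun s => p (a s))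
    (b := fun s => p (b s)) (hp.comp (ha.comp continuous_subtype_val))
    (hp.comp (hb.comp continuous_subtype_val))
    (fun y => by rw [hpq, hpq, hab y y.2]) (y₀ := ⟨t, ht⟩) h ⟨s, hs⟩

-- Straightening: `p` lifts the polygon, `P` is its barycentric replacement, and `f` is the
-- equivariant map with `f ∘ p = P`. Compactness of the disk bounds the displacement of `f`, so `f`
-- is onto. The compact set `K` later ensures that only finitely many translates are involved.
open UpperHalfPlane in
theorem exists_triangles_cover {m : ℕ} (hm : 2 ≤ m) {R : UnitDisk → UnitDisk → Prop}
    (hR : IsEdgeGluing m R) {q : UnitDisk → OrbitSpace Δ ℍ} (hq : Continuous q)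
    (hqs : Function.Surjective q) (hqR : ∀ x y, q x = q y ↔ Relation.EqvGen R x y) :
    ∃ (w : ℕ → ℍ) (K : Set ℍ), IsCompact K ∧ w m = w 0 ∧ ∀ x : ℍ, ∃ δ : Δ, δ • x ∈ K ∧
      ∃ j < m, δ • x ∈ geodesicTriangle (w 0) (w j) (w (j + 1)) := by
  obtain ⟨p, hp, hpq⟩ := exists_lift_unitDisk hq
  let w : ℕ → ℍ := fun j => p (edgePoint m j 0)
  have hw1 (j : ℕ) : p (edgePoint m j 1) = w (j + 1) := by
    simp only [w]
    congr 1
    exact Subtype.ext (polygonEdge_one m j)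
  have hwm : w m = w 0 := by
    simp only [w]
    congr 1
    exact Subtype.ext (polygonEdge_self (by omega))
  have hnorm (z : UnitDisk) : ‖(z : ℂ)‖ ≤ 1 := mem_closedBall_zero_iff.1 z.2
  obtain ⟨P, hP, hPb⟩ := exists_continuous_isBarycenter (X := UnitDisk)
    (fun l : Fin m => w l) (k := fun z => polygonWeight m z)
    ((continuous_polygonWeight m).comp continuous_subtype_val)
    (fun z l => polygonWeight_nonneg (hnorm z) l)
    (fun z => by rw [sum_polygonWeight_eq_one hm]; exact one_pos)
  have hPb' (z : UnitDisk) {j : ℕ} (hj : j < m) {r t : ℝ} (hr : 0 ≤ r)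
      (ht : t ∈ Set.Icc (0 : ℝ) 1) (hz : (z : ℂ) = r * polygonEdge m j t) :
      IsBarycenter (fun v => (1 - r) * Real.cosh (dist (w 0) v) +
        r * ((1 - t) * Real.cosh (dist (w j) v) + t * Real.cosh (dist (w (j + 1)) v))) (P z) := by
    have := hPb z
    simp only [hz] at this
    convert this using 2 with v
    exact (sum_polygonWeight hm hj hr ht (fun l => Real.cosh (dist (w l) v)) (by rw [hwm])).symm
  have hPe {j : ℕ} (hj : j < m) {t : ℝ} (ht : t ∈ Set.Icc (0 : ℝ) 1) :
      IsBarycenter (fun v => (1 - t) * Real.cosh (dist (w j) v) +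
        t * Real.cosh (dist (w (j + 1)) v)) (P (edgePoint m j t)) := by
    simpa using hPb' (edgePoint m j t) hj zero_le_one ht (by simp [edgePoint])
  have hdist (δ : Δ) (a v : ℍ) : dist a (δ⁻¹ • v) = dist (δ • a) v := by
    rw [← dist_smul δ, smul_inv_smul]
  -- The `δ` matching one pair of glued points matches the whole edges, hence their endpoints, hence
  -- the straightened edges by uniqueness of barycenters. The induction extends this to the
  -- generated equivalence relation.
  have hglue (x y : UnitDisk) (h : q x = q y) : ∃ δ : Δ, p y = δ • p x ∧ P y = δ • P x := by
    have hxy := (hqR x y).1 h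
    clear h
    induction hxy with
    | rel x y hxy =>
      have hq' (a b : UnitDisk) (hab : R a b) : q a = q b := (hqR a b).2 (.rel _ _ hab)
      obtain ⟨δ, hδ⟩ : ∃ δ : Δ, δ • p x = p y :=
        OrbitSpace.proj_eq_proj_iff.1 (by rw [hpq, hpq, hq' x y hxy])
      refine ⟨δ, hδ.symm, ?_⟩
      obtain ⟨j, hj, j', hj', t, ht, ⟨rfl, rfl, hall⟩ | ⟨rfl, rfl, hall⟩⟩ := hR x y hxy
      · have key := smul_edge_eq hp hpq (continuous_edgePoint m j) (continuous_edgePoint m j')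
          (fun s hs => hq' _ _ (hall s hs)) ht hδ.symm
        have k0 : w j' = δ • w j := key 0 ⟨le_rfl, zero_le_one⟩
        have k1 : w (j' + 1) = δ • w (j + 1) := by
          rw [← hw1, ← hw1]; exact key 1 ⟨zero_le_one, le_rfl⟩
        refine (hPe hj' ht).unique ?_
        have := (hPe hj ht).smul δ
        simpa only [hdist, k0, k1] using this
      · have ht' : 1 - t ∈ Set.Icc (0 : ℝ) 1 := ⟨by linarith [ht.2], by linarith [ht.1]⟩
        have key := smul_edge_eq hp hpq (continuous_edgePoint m j)
          ((continuous_edgePoint m j').comp (continuous_const.sub continuous_id))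
          (fun s hs => hq' _ _ (hall s hs)) ht hδ.symm
        have k0 : w (j' + 1) = δ • w j := by
          have := key 0 ⟨le_rfl, zero_le_one⟩
          rw [← hw1]
          simpa using this
        have k1 : w j' = δ • w (j + 1) := by
          have := key 1 ⟨zero_le_one, le_rfl⟩
          rw [hw1] at this
          simpa using this
        refine (hPe hj' ht').unique ?_
        have := (hPe hj ht).smul δ
        simp only [hdist, ← k0, ← k1] at this
        convert this using 2
        ring
    | refl x => exact ⟨1, by simp, by simp⟩
    | symm x y _ ih =>
      obtain ⟨δ, h1, h2⟩ := ih
      exact ⟨δ⁻¹, by rw [h1, inv_smul_smul], by rw [h2, inv_smul_smul]⟩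
    | trans x y z _ _ ih1 ih2 =>
      obtain ⟨δ, h1, h2⟩ := ih1
      obtain ⟨ε, h3, h4⟩ := ih2
      exact ⟨ε * δ, by rw [mul_smul, ← h1, h3], by rw [mul_smul, ← h2, h4]⟩
  have hcov (x : ℍ) : ∃ δ : Δ, ∃ z, x = δ • p z := by
    obtain ⟨z, hz⟩ := hqs (OrbitSpace.proj Δ x)
    obtain ⟨δ, hδ⟩ := OrbitSpace.proj_eq_proj_iff.1 (hz.symm.trans (hpq z).symm)
    exact ⟨δ, z, hδ.symm⟩
  choose d z hdz using hcov
  let f : ℍ → ℍ := fun x => d x • P (z x)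
  have hfp (δ : Δ) (y : UnitDisk) : f (δ • p y) = δ • P y := by
    have h1 := hdz (δ • p y)
    have h2 : q y = q (z (δ • p y)) := by
      rw [← hpq, ← hpq, ← OrbitSpace.proj_smul (d (δ • p y)) (p (z (δ • p y))), ← h1,
        OrbitSpace.proj_smul]
    obtain ⟨ε, h3, h4⟩ := hglue _ _ h2
    rw [h3, smul_smul] at h1
    -- Freeness of the action makes `f` independent of the choices `d` and `z`.
    have h5 : δ = d (δ • p y) * ε := IsCancelSMul.right_cancel _ _ _ h1
    simp only [f]
    rw [h4, smul_smul, ← h5]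
  have hfequiv (δ : Δ) (x : ℍ) : f (δ • x) = δ • f x := by
    obtain ⟨ε, y, hy⟩ : ∃ ε : Δ, ∃ y, x = ε • p y := ⟨d x, z x, hdz x⟩
    rw [hy, hfp, smul_smul, hfp, smul_smul]
  have hfp1 (y : UnitDisk) : f (p y) = P y := by simpa using hfp 1 y
  have hfc : Continuous f := by
    refine continuous_of_continuous_comp_of_equivariant (Δ := Δ) hp
      (fun x => ⟨d x, z x, hdz x⟩) ?_ hfequiv
    simpa only [Function.comp_def, hfp1] using hP
  obtain ⟨C, hC⟩ := (isCompact_range (hP.dist hp)).bddAbove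
  have hsurj : Function.Surjective f := by
    refine surjective_of_dist_le hfc (C := C) fun x => ?_
    conv_lhs => rw [hdz x]
    rw [hfp, dist_smul]
    exact hC ⟨z x, rfl⟩
  refine ⟨w, Set.range P, isCompact_range hP, hwm, fun x => ?_⟩
  obtain ⟨x', rfl⟩ := hsurj x
  refine ⟨(d x')⁻¹, ?_⟩
  have : (d x')⁻¹ • f x' = P (z x') := by simp only [f, inv_smul_smul]
  rw [this]
  refine ⟨⟨_, rfl⟩, ?_⟩
  obtain ⟨j, hj, t, ht, hz⟩ := exists_eq_smul_polygonEdge (by omega : 0 < m) (z x' : ℂ)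
  refine ⟨j, hj, ?_⟩
  obtain ⟨r, hr, h⟩ := hPb' _ hj (norm_nonneg _) ht hz
  have hn := hnorm (z x')
  refine ⟨(1 - ‖(z x' : ℂ)‖) / r, ‖(z x' : ℂ)‖ * (1 - t) / r, ‖(z x' : ℂ)‖ * t / r,
    div_nonneg (by linarith) hr.le,
    div_nonneg (mul_nonneg (norm_nonneg _) (by linarith [ht.2])) hr.le,
    div_nonneg (mul_nonneg (norm_nonneg _) ht.1) hr.le, fun v => ?_⟩
  apply mul_left_cancel₀ hr.ne'
  rw [h v]
  field_simp
  ring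

end Polygon

/-! ### Embedded disks in closed hyperbolic surfaces -/

namespace UpperHalfPlane

theorem volume_geodesicTriangle_self_left (a c : ℍ) : volume (geodesicTriangle a a c) = 0 := by
  obtain ⟨g, ha, hc, -⟩ := exists_smul_eq_I_of_re_eq_zero a c
  refine measure_mono_null (t := (fun z => g • z) ⁻¹' {z : ℍ | z.re = 0}) (fun q hq => ?_) ?_
  · obtain ⟨k, l, m, -, -, -, -, h, -⟩ :=
      geodesicTriangle_coords (smul_mem_geodesicTriangle g hq)
    simpa [ha, hc, (g • q).im_ne_zero] using h
  · rw [volume_preimage_of_isometry (isometry_smul ℍ g), volume_re_eq_zero]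

theorem volume_geodesicTriangle_self_right (a b : ℍ) : volume (geodesicTriangle a b a) = 0 := by
  refine measure_mono_null (fun q hq => ?_) (volume_geodesicTriangle_self_left a b)
  obtain ⟨k, l, m, hk, hl, hm, h⟩ := hq
  exact ⟨k, m, l, hk, hm, hl, fun v => by rw [h v]; ring⟩

/-- The first and the last triangle of the fan have two equal vertices and area zero, which leaves
`m - 2`. -/
theorem sum_volume_geodesicTriangle_le {m : ℕ} (hm : 2 ≤ m) {w : ℕ → ℍ} (hw : w m = w 0) :
    ∑ j ∈ Finset.range m, volume (geodesicTriangle (w 0) (w j) (w (j + 1))) ≤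
      ENNReal.ofReal ((m - 2) * Real.pi) := by
  obtain ⟨n, rfl⟩ := Nat.exists_eq_add_of_le' hm
  rw [Finset.sum_range_succ, Finset.sum_range_succ', zero_add,
    volume_geodesicTriangle_self_left, hw, volume_geodesicTriangle_self_right, add_zero, add_zero]
  calc _ ≤ ∑ _j ∈ Finset.range n, ENNReal.ofReal Real.pi :=
        Finset.sum_le_sum fun j _ => volume_geodesicTriangle_le _ _ _
    _ = _ := by
        rw [Finset.sum_const, Finset.card_range, nsmul_eq_mul, ENNReal.ofReal_mul
          (by push_cast; linarith [n.cast_nonneg (α := ℝ)])]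
        congr 1
        push_cast
        rw [add_sub_cancel_right, ENNReal.ofReal_natCast]

end UpperHalfPlane

section Surface

variable {Δ : Type*} [Group Δ] [MulAction Δ ℍ] [IsIsometricSMul Δ ℍ]

/-- The pieces of `U` carried into `T` by the various `δ` land in disjoint translates of `U`, so
together they fit into `T`. -/
theorem sum_volume_inter_smul_le (U T : Set ℍ) (hU : MeasurableSet U)
    (hdisj : ∀ δ : Δ, δ ≠ 1 → Disjoint (δ • U) U) (F : Finset Δ) :
    ∑ δ ∈ F, volume (U ∩ (fun z => δ • z) ⁻¹' T) ≤ volume T := by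
  have hmeas (δ : Δ) : MeasurableSet (δ • U) := by
    rw [← Set.preimage_smul_inv]
    exact (continuous_const_smul δ⁻¹).measurable hU
  have h1 (δ : Δ) : volume (U ∩ (fun z => δ • z) ⁻¹' T) = volume.restrict T (δ • U) := by
    rw [Measure.restrict_apply (hmeas δ),
      ← UpperHalfPlane.volume_preimage_of_isometry (isometry_smul ℍ δ) (δ • U ∩ T)]
    congr 1
    ext z
    simp [Set.smul_mem_smul_set_iff]
  simp only [h1]
  rw [← measure_biUnion_finset _ fun δ _ => hmeas δ]
  · exact (measure_mono (Set.subset_univ _)).trans_eq (by simp)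
  · intro δ _ ε _ hne
    have h2 := hdisj (ε⁻¹ * δ) (by rwa [Ne, inv_mul_eq_one, eq_comm])
    rw [Function.onFun, Set.disjoint_left]
    intro z hz hz'
    rw [Set.mem_smul_set_iff_inv_smul_mem] at hz hz'
    refine Set.disjoint_left.1 h2 ?_ hz'
    rw [Set.mem_smul_set_iff_inv_smul_mem, smul_smul]
    simpa using hz

variable [ProperlyDiscontinuousSMul Δ ℍ] [IsCancelSMul Δ ℍ]

-- The embedded ball is cut up by the translates of the fan, giving `2π (cosh r - 1) ≤ (m - 2) π`.
-- Only the finitely many `δ` moving the closed ball to meet `K` occur.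
open UpperHalfPlane in
theorem cosh_le_of_isEdgeGluing {m : ℕ} (hm : 2 ≤ m) {R : UnitDisk → UnitDisk → Prop}
    (hR : IsEdgeGluing m R) (e : OrbitSpace Δ ℍ ≃ₜ Quot R) (x : ℍ) {r : ℝ} (hr : 0 < r)
    (hdisj : ∀ δ : Δ, δ ≠ 1 → Disjoint (δ • Metric.ball x r) (Metric.ball x r)) :
    2 * Real.cosh r ≤ m := by
  obtain ⟨w, K, hK, hw, hcov⟩ := exists_triangles_cover (Δ := Δ) hm hR
    (q := fun z => e.symm (Quot.mk R z)) (e.symm.continuous.comp continuous_quot_mk)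
    (e.symm.surjective.comp Quot.mk_surjective)
    (fun a b => by rw [e.symm.injective.eq_iff, Quot.eq])
  let F : Finset Δ := (ProperlyDiscontinuousSMul.finite_disjoint_inter_image (Γ := Δ)
    (isCompact_closedBall x r) hK).toFinset
  let T : ℕ → Set ℍ := fun j => geodesicTriangle (w 0) (w j) (w (j + 1))
  have hsub : Metric.ball x r ⊆ ⋃ j ∈ Finset.range m, ⋃ δ ∈ F,
      (Metric.ball x r ∩ (fun z => δ • z) ⁻¹' T j) := by
    intro y hy
    obtain ⟨δ, h1, j, hj, h2⟩ := hcov y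
    have hδ : δ ∈ F := (Set.Finite.mem_toFinset _).2
      ⟨δ • y, ⟨y, Metric.ball_subset_closedBall hy, rfl⟩, h1⟩
    simp only [Set.mem_iUnion]
    exact ⟨j, Finset.mem_range.2 hj, δ, hδ, hy, h2⟩
  have h1 : volume (Metric.ball x r) ≤ ENNReal.ofReal ((m - 2) * Real.pi) := by
    refine (measure_mono hsub).trans ((measure_biUnion_finset_le _ _).trans ?_)
    refine (Finset.sum_le_sum fun j _ => ?_).trans (sum_volume_geodesicTriangle_le hm hw)
    exact (measure_biUnion_finset_le _ _).trans
      (sum_volume_inter_smul_le _ _ measurableSet_ball hdisj F)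
  have hm' : (2 : ℝ) ≤ m := by exact_mod_cast hm
  have h2 := (le_volume_ball x hr).trans h1
  rw [ENNReal.ofReal_le_ofReal_iff (mul_nonneg (by linarith) Real.pi_pos.le)] at h2
  have := Real.pi_pos
  nlinarith

theorem isEdgeGluing_orientableGluing {n : ℕ} : IsEdgeGluing (4 * n) (orientableGluing n) := by
  rintro x y ⟨i, hi, t, ht, ⟨hx, hy⟩ | ⟨hx, hy⟩⟩
  · exact ⟨4 * i, by omega, 4 * i + 2, by omega, t, ht, Or.inr ⟨Subtype.ext hx, Subtype.ext hy,
      fun s hs => ⟨i, hi, s, hs, Or.inl ⟨rfl, rfl⟩⟩⟩⟩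
  · exact ⟨4 * i + 1, by omega, 4 * i + 3, by omega, t, ht, Or.inr ⟨Subtype.ext hx,
      Subtype.ext hy, fun s hs => ⟨i, hi, s, hs, Or.inr ⟨rfl, rfl⟩⟩⟩⟩

theorem isEdgeGluing_nonorientableGluing {k : ℕ} :
    IsEdgeGluing (2 * k) (nonorientableGluing k) := by
  rintro x y ⟨i, hi, t, ht, hx, hy⟩
  exact ⟨2 * i, by omega, 2 * i + 1, by omega, t, ht, Or.inl ⟨Subtype.ext hx, Subtype.ext hy,
    fun s hs => ⟨i, hi, s, hs, rfl, rfl⟩⟩⟩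

theorem IsClosedSurfaceOfGenus.half_le {S : Type*} [TopologicalSpace S] {g : ℝ}
    (hg : IsClosedSurfaceOfGenus S g) : 1 / 2 ≤ g := by
  obtain ⟨n, hn, -, rfl⟩ | ⟨k, hk, -, rfl⟩ := hg
  · have : (1 : ℝ) ≤ n := by exact_mod_cast hn
    linarith
  · have : (1 : ℝ) ≤ k := by exact_mod_cast hk
    linarith

theorem IsClosedSurfaceOfGenus.cosh_le {g : ℝ} (hg : IsClosedSurfaceOfGenus (OrbitSpace Δ ℍ) g)
    (x : ℍ) {r : ℝ} (hr : 0 ≤ r)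
    (hdisj : ∀ δ : Δ, δ ≠ 1 → Disjoint (δ • Metric.ball x r) (Metric.ball x r)) :
    Real.cosh r ≤ 2 * g := by
  rcases hr.eq_or_lt with rfl | hr
  · rw [Real.cosh_zero]
    linarith [hg.half_le]
  obtain ⟨n, hn, ⟨e⟩, rfl⟩ | ⟨k, hk, ⟨e⟩, rfl⟩ := hg
  · have := cosh_le_of_isEdgeGluing (by omega) isEdgeGluing_orientableGluing e x hr hdisj
    push_cast at this
    linarith
  · have := cosh_le_of_isEdgeGluing (by omega) isEdgeGluing_nonorientableGluing e x hr hdisj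
    push_cast at this
    linarith

end Surface

/-! ### Hyperbolic space: coordinates -/

theorem sinh_half_log_sub_log {a b : ℝ} (ha : 0 < a) (hb : 0 < b) :
    Real.sinh ((Real.log a - Real.log b) / 2) = (a - b) / (2 * √(a * b)) := by
  have hs := Real.sqrt_pos.2 ha
  have ht := Real.sqrt_pos.2 hb
  have h1 : (Real.log a - Real.log b) / 2 = Real.log (√a / √b) := by
    rw [Real.log_div hs.ne' ht.ne', Real.log_sqrt ha.le, Real.log_sqrt hb.le]
    ring
  rw [h1, Real.sinh_log (by positivity), Real.sqrt_mul ha.le]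
  have e1 : a = √a ^ 2 := (Real.sq_sqrt ha.le).symm
  have e2 : b = √b ^ 2 := (Real.sq_sqrt hb.le).symm
  rw [show a - b = √a ^ 2 - √b ^ 2 by rw [← e1, ← e2]]
  field_simp

namespace HypSpace

/-- `log z` is, up to sign, the Busemann function of the point at infinity; it measures depth inside
the horoball `z ≥ 1`. -/
theorem abs_log_sub_log_le_dist (p q : HypSpace) : |Real.log p.z - Real.log q.z| ≤ dist p q := by
  have hp := p.z_pos
  have hq := q.z_pos
  have h1 : Real.sinh (|Real.log p.z - Real.log q.z| / 2) ≤ Real.sinh (dist p q / 2) := by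
    rw [sinh_half_dist]
    have h2 : |Real.log p.z - Real.log q.z| / 2 = |(Real.log p.z - Real.log q.z) / 2| := by
      rw [abs_div, abs_two]
    rw [h2, ← Real.abs_sinh, sinh_half_log_sub_log hp hq, abs_div,
      abs_of_pos (by positivity : 0 < 2 * √(p.z * q.z)), dist_toE]
    gcongr
    rw [← Real.sqrt_sq_eq_abs]
    apply Real.sqrt_le_sqrt
    nlinarith [sq_nonneg (p.x - q.x), sq_nonneg (p.y - q.y)]
  have := Real.sinh_le_sinh.1 h1
  linarith

theorem dist_eq_abs_log_sub_log {p q : HypSpace} (hx : p.x = q.x) (hy : p.y = q.y) :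
    dist p q = |Real.log p.z - Real.log q.z| := by
  have hp := p.z_pos
  have hq := q.z_pos
  have h1 : Real.sinh (dist p q / 2) = Real.sinh (|Real.log p.z - Real.log q.z| / 2) := by
    have h2 : |Real.log p.z - Real.log q.z| / 2 = |(Real.log p.z - Real.log q.z) / 2| := by
      rw [abs_div, abs_two]
    rw [sinh_half_dist, h2, ← Real.abs_sinh, sinh_half_log_sub_log hp hq, abs_div,
      abs_of_pos (by positivity : 0 < 2 * √(p.z * q.z)), dist_toE, hx, hy]
    congr 1
    rw [← Real.sqrt_sq_eq_abs]
    congr 1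
    ring
  have := Real.sinh_injective h1
  linarith

theorem continuous_log_z : Continuous fun p : HypSpace => Real.log p.z :=
  (LipschitzWith.of_dist_le' (K := 1) fun p q => by
    rw [one_mul, Real.dist_eq]
    exact abs_log_sub_log_le_dist p q).continuous

theorem continuous_z : Continuous fun p : HypSpace => p.z := by
  have h : (fun p : HypSpace => p.z) = fun p => Real.exp (Real.log p.z) :=
    funext fun p => (Real.exp_log p.z_pos).symm
  rw [h]
  exact Real.continuous_exp.comp continuous_log_z

theorem dist_toE_eq (p q : HypSpace) :
    dist p.toE q.toE = 2 * √(p.z * q.z) * Real.sinh (dist p q / 2) := by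
  have hp := p.z_pos
  have hq := q.z_pos
  have : √(p.z * q.z) ≠ 0 := (Real.sqrt_pos.2 (mul_pos hp hq)).ne'
  rw [sinh_half_dist]
  field_simp

theorem continuous_toE : Continuous toE := by
  rw [continuous_iff_continuousAt]
  intro q
  rw [ContinuousAt, tendsto_iff_dist_tendsto_zero]
  simp only [dist_toE_eq]
  have h1 : Continuous fun p : HypSpace => 2 * √(p.z * q.z) * Real.sinh (dist p q / 2) := by
    have := continuous_z
    fun_prop
  simpa using h1.tendsto q

theorem continuous_x : Continuous fun p : HypSpace => p.x := by
  have h : (fun p : HypSpace => p.x) = fun p => p.toE 0 := funext fun p => by simp [toE]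
  rw [h]
  exact (EuclideanSpace.proj (𝕜 := ℝ) (0 : Fin 3)).continuous.comp continuous_toE

theorem continuous_y : Continuous fun p : HypSpace => p.y := by
  have h : (fun p : HypSpace => p.y) = fun p => p.toE 1 := funext fun p => by simp [toE]
  rw [h]
  exact (EuclideanSpace.proj (𝕜 := ℝ) (1 : Fin 3)).continuous.comp continuous_toE

/-- The coordinates `(x, y, log z)`. -/
def homeomorphProd : HypSpace ≃ₜ ℝ × ℝ × ℝ where
  toFun p := (p.x, p.y, Real.log p.z)
  invFun v := ⟨v.1, v.2.1, Real.exp v.2.2, Real.exp_pos _⟩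
  left_inv p := by ext <;> simp [Real.exp_log p.z_pos]
  right_inv v := by simp
  continuous_toFun := continuous_x.prodMk (continuous_y.prodMk continuous_log_z)
  continuous_invFun := by
    rw [continuous_iff_continuousAt]
    intro v
    rw [ContinuousAt, tendsto_iff_dist_tendsto_zero]
    have h1 : Continuous fun u : ℝ × ℝ × ℝ =>
        dist (⟨u.1, u.2.1, Real.exp u.2.2, Real.exp_pos _⟩ : HypSpace)
          ⟨v.1, v.2.1, Real.exp v.2.2, Real.exp_pos _⟩ := by
      simp only [dist_eq, dist_toE]
      refine continuous_const.mul (Real.continuous_arsinh.comp (Continuous.div (by fun_prop)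
        (by fun_prop) fun u => ?_))
      positivity
    simpa using h1.tendsto v

instance : LocallyCompactSpace HypSpace :=
  homeomorphProd.isClosedEmbedding.locallyCompactSpace

instance : ContractibleSpace HypSpace :=
  homeomorphProd.contractibleSpace_iff.2 inferInstance

/-- A continuous map of a square with prescribed values on the boundary. -/
theorem exists_square {a b c d : HypSpace} (bottom : Path a b) (top : Path c d) (left : Path a c)
    (right : Path b d) : ∃ F : C(unitInterval × unitInterval, HypSpace),
      (∀ t, F (t, 0) = bottom t) ∧ (∀ t, F (t, 1) = top t) ∧ (∀ s, F (0, s) = left s) ∧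
        ∀ s, F (1, s) = right s := by
  let h := homeomorphProd
  -- Coons patch: the two ruled interpolations are added and the bilinear interpolation of the
  -- corners is subtracted.
  let F : unitInterval × unitInterval → ℝ × ℝ × ℝ := fun ts =>
    (1 - (ts.2 : ℝ)) • h (bottom ts.1) + (ts.2 : ℝ) • h (top ts.1)
      + (1 - (ts.1 : ℝ)) • h (left ts.2) + (ts.1 : ℝ) • h (right ts.2)
      - ((1 - (ts.1 : ℝ)) * (1 - ts.2)) • h a - (ts.1 * (1 - ts.2) : ℝ) • h b
      - ((1 - (ts.1 : ℝ)) * ts.2) • h c - (ts.1 * ts.2 : ℝ) • h d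
  have hF : Continuous F := by
    have := h.continuous
    fun_prop
  refine ⟨⟨fun ts => h.symm (F ts), h.symm.continuous.comp hF⟩, ?_, ?_, ?_, ?_⟩
  all_goals
    intro t
    simp only [ContinuousMap.coe_mk]
    rw [Homeomorph.symm_apply_eq]
    simp only [F, Path.source, Path.target, Set.Icc.coe_zero, Set.Icc.coe_one]
    module

end HypSpace

/-! ### Geodesics of the hyperbolic plane -/

theorem UpperHalfPlane.exists_isGeodesicOn (a b : ℍ) : ∃ c : ℝ → ℍ, Continuous c ∧ c 0 = a ∧
    c (dist a b) = b ∧ IsGeodesicOn c (Set.Icc 0 (dist a b)) := by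
  obtain ⟨g, ha, hb, hb'⟩ := exists_smul_eq_I_of_re_eq_zero a b
  have hiso := isometry_vertical_line 0
  have hc : Isometry fun y : ℝ => g⁻¹ • (mk ⟨0, Real.exp y⟩ (Real.exp_pos y) : ℍ) :=
    (isometry_smul ℍ g⁻¹).comp hiso
  have hd : dist a b = Real.log (g • b).im := by
    rw [← dist_smul g, ha, dist_of_re_eq (by rw [hb, I_re]), I_im, Real.log_one, dist_comm,
      dist_zero_right, Real.norm_of_nonneg (Real.log_nonneg hb')]
  refine ⟨_, hc.continuous, ?_, ?_, fun s _ t _ => by rw [hc.dist_eq, Real.dist_eq]⟩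
  · rw [inv_smul_eq_iff, ha]
    apply UpperHalfPlane.ext
    apply Complex.ext <;> simp
  · rw [inv_smul_eq_iff, hd]
    apply UpperHalfPlane.ext
    apply Complex.ext <;> simp [hb, Real.exp_log (g • b).im_pos]

/-! ### Lifts of loops -/

theorem IsCoveringMap.apply_one_eq_of_homotopic_refl {E X : Type*} [TopologicalSpace E]
    [TopologicalSpace X] {p : E → X} (cov : IsCoveringMap p) {x : X} {l : Path x x}
    (h : l.Homotopic (Path.refl x)) (L : C(unitInterval, E)) (hL : ∀ t, p (L t) = l t) :
    L 1 = L 0 := by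
  have h0 : l 0 = p (L 0) := (hL 0).symm
  have h0' : (Path.refl x) 0 = p (L 0) := by rw [hL]; simp
  have h1 := cov.liftPath_apply_one_eq_of_homotopicRel (γ₀ := l) (γ₁ := Path.refl x) h (L 0) h0 h0'
  have h2 : L = cov.liftPath l (L 0) h0 :=
    (cov.eq_liftPath_iff' h0).2 ⟨funext fun t => hL t, rfl⟩
  have h3 : ContinuousMap.const unitInterval (L 0) = cov.liftPath (Path.refl x) (L 0) h0' :=
    (cov.eq_liftPath_iff' h0').2 ⟨funext fun t => by simpa using h0'.symm, rfl⟩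
  rw [← h2, ← h3] at h1
  simpa using h1

section Lift

variable {Γ : Type*} [Group Γ] [MulAction Γ HypSpace] [IsIsometricSMul Γ HypSpace]
    [ProperlyDiscontinuousSMul Γ HypSpace] [IsCancelSMul Γ HypSpace]
    {Δ : Type*} [Group Δ] [MulAction Δ ℍ]

/-- The geodesic from `a` to `b` has an image of length `dist a b`, and length bounds distance. The
lift of this image supplied by the pleated structure is a `Γ`-translate of the one given by `Φ`. -/
theorem IsPleatedSurface.dist_lift_le {φ : C(OrbitSpace Δ ℍ, OrbitSpace Γ HypSpace)}
    (hφ : IsPleatedSurface φ) {Φ : C(ℍ, HypSpace)}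
    (hΦ : ∀ y, OrbitSpace.proj Γ (Φ y) = φ (OrbitSpace.proj Δ y)) (a b : ℍ) :
    dist (Φ a) (Φ b) ≤ dist a b := by
  obtain ⟨c, hc, rfl, hcb, hgeo⟩ := UpperHalfPlane.exists_isGeodesicOn a b
  set l := dist (c 0) b
  have hl : 0 ≤ l := dist_nonneg
  obtain ⟨c', hc', ⟨hcont, -⟩, hvar⟩ := hφ.isometric l c hl hgeo
  have h0 : (0 : ℝ) ∈ Set.Icc 0 l := ⟨le_rfl, hl⟩
  have h1 : l ∈ Set.Icc 0 l := ⟨hl, le_rfl⟩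
  have : PreconnectedSpace (Set.Icc 0 l) :=
    isPreconnected_iff_preconnectedSpace.1 isPreconnected_Icc
  obtain ⟨γ, hγ⟩ := OrbitSpace.proj_eq_proj_iff.1 ((hc' 0 h0).trans (hΦ (c 0)).symm)
  have key := OrbitSpace.eq_smul_of_proj_comp_eq (G := Γ) (Y := Set.Icc 0 l)
    (a := fun t => Φ (c t)) (b := fun t => c' t)
    (Φ.continuous.comp (hc.comp continuous_subtype_val)) hcont.domRestrict
    (fun t => by rw [hc' t t.2, hΦ]) (y₀ := ⟨0, h0⟩) hγ.symm
  have k1 : c' l = γ • Φ (c l) := key ⟨l, h1⟩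
  have hle := eVariationOn.edist_le c' h0 h1
  rw [hvar, ← hγ, k1, hcb, (isometry_smul HypSpace γ).edist_eq, edist_dist] at hle
  exact (ENNReal.ofReal_le_ofReal_iff hl).1 hle

variable [IsIsometricSMul Δ ℍ]

theorem exists_lift_smul_eq {φ : C(OrbitSpace Δ ℍ, OrbitSpace Γ HypSpace)} {Φ : C(ℍ, HypSpace)}
    (hΦ : ∀ y, OrbitSpace.proj Γ (Φ y) = φ (OrbitSpace.proj Δ y)) (δ : Δ) :
    ∃ γ : Γ, ∀ y, Φ (δ • y) = γ • Φ y := by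
  have h (y : ℍ) : OrbitSpace.proj Γ (Φ (δ • y)) = OrbitSpace.proj Γ (Φ y) := by
    rw [hΦ, hΦ, OrbitSpace.proj_smul]
  obtain ⟨γ, hγ⟩ := OrbitSpace.proj_eq_proj_iff.1 (h UpperHalfPlane.I)
  exact ⟨γ, OrbitSpace.eq_smul_of_proj_comp_eq Φ.continuous
    (Φ.continuous.comp (continuous_const_smul δ)) h hγ.symm⟩

variable [ProperlyDiscontinuousSMul Δ ℍ] [IsCancelSMul Δ ℍ]

theorem exists_lift_of_proj_eq (φ : C(OrbitSpace Δ ℍ, OrbitSpace Γ HypSpace)) {x : ℍ}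
    {b : HypSpace} (h : OrbitSpace.proj Γ b = φ (OrbitSpace.proj Δ x)) :
    ∃ Φ : C(ℍ, HypSpace), Φ x = b ∧ ∀ y, OrbitSpace.proj Γ (Φ y) = φ (OrbitSpace.proj Δ y) := by
  have hc : Continuous (OrbitSpace.proj Δ : ℍ → OrbitSpace Δ ℍ) :=
    OrbitSpace.isCoveringMap_proj.continuous
  obtain ⟨F, ⟨h1, h2⟩, -⟩ := (OrbitSpace.isCoveringMap_proj (G := Γ)
    (X := HypSpace)).existsUnique_continuousMap_lifts (φ.comp ⟨_, hc⟩) x b h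
  exact ⟨F, h1, fun y => congrFun h2 y⟩

/-- A path from `x` to `δ x` projects to a loop whose image lifts to a closed loop in a contractible
space. By injectivity the loop itself is null-homotopic, so its lift closes and `δ x = x`. -/
theorem IsIncompressible.eq_one_of_lift_smul_eq {φ : C(OrbitSpace Δ ℍ, OrbitSpace Γ HypSpace)}
    (hinc : IsIncompressible φ) {Φ : C(ℍ, HypSpace)}
    (hΦ : ∀ y, OrbitSpace.proj Γ (Φ y) = φ (OrbitSpace.proj Δ y)) {δ : Δ} {x : ℍ}
    (h : Φ (δ • x) = Φ x) : δ = 1 := by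
  have hcΔ : Continuous (OrbitSpace.proj Δ : ℍ → OrbitSpace Δ ℍ) :=
    OrbitSpace.isCoveringMap_proj.continuous
  have hcΓ : Continuous (OrbitSpace.proj Γ : HypSpace → OrbitSpace Γ HypSpace) :=
    OrbitSpace.isCoveringMap_proj.continuous
  let α : Path x (δ • x) := PathConnectedSpace.somePath x (δ • x)
  let a : Path (OrbitSpace.proj Δ x) (OrbitSpace.proj Δ x) :=
    (α.map hcΔ).cast rfl (OrbitSpace.proj_smul δ x).symm
  let L : Path (Φ x) (Φ x) := (α.map Φ.continuous).cast rfl h.symm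
  have h1 : (a.map φ.continuous).Homotopic (Path.refl _) := by
    have h2 : L.Homotopic (Path.refl _) := SimplyConnectedSpace.paths_homotopic _ _
    have h3 := (h2.map ⟨_, hcΓ⟩).pathCast (hΦ x).symm (hΦ x).symm
    convert h3 using 1
    · ext t
      exact (hΦ (α t)).symm
    · ext t
      exact (hΦ x).symm
  have h2 : FundamentalGroup.fromPath (Path.Homotopic.Quotient.mk a) = 1 := by
    apply hinc
    rw [map_one]
    exact Path.Homotopic.Quotient.eq.2 h1
  have h3 : a.Homotopic (Path.refl _) := Path.Homotopic.Quotient.eq.1 h2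
  have h4 := OrbitSpace.isCoveringMap_proj.apply_one_eq_of_homotopic_refl h3 α.toContinuousMap
    fun t => rfl
  have h5 : δ • x = (1 : Δ) • x := by simpa using h4
  exact IsCancelSMul.right_cancel _ _ _ h5

/-! ### Annuli -/

theorem exists_circle_map {Y : Type*} [TopologicalSpace Y] (f : C(unitInterval, Y))
    (h : f 0 = f 1) :
    ∃ a : C(Circle, Y), ∀ t : unitInterval, a (Circle.exp (2 * Real.pi * t)) = f t := by
  let g : ℝ → Y := fun t => f (Set.projIcc 0 1 zero_le_one t)
  have hg : Continuous g := f.continuous.comp continuous_projIcc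
  have h01 : g 0 = g (0 + 1) := by simpa [g] using h
  have hG := AddCircle.liftIco_continuous (p := (1 : ℝ)) (a := 0) h01 hg.continuousOn
  have hkey (t : unitInterval) :
      AddCircle.liftIco (1 : ℝ) 0 g ((t : ℝ) : AddCircle (1 : ℝ)) = f t := by
    rcases t.2.2.eq_or_lt with h1 | h1
    · have e : ((t : ℝ) : AddCircle (1 : ℝ)) = ((0 : ℝ) : AddCircle (1 : ℝ)) := by
        rw [h1]; simp
      have et : t = 1 := Subtype.ext h1
      rw [e, AddCircle.liftIco_coe_apply ⟨le_rfl, by norm_num⟩, et, ← h]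
      simp [g]
    · rw [AddCircle.liftIco_coe_apply ⟨t.2.1, by simpa using h1⟩]
      simp [g]
  let e := AddCircle.homeomorphCircle (T := (1 : ℝ)) one_ne_zero
  refine ⟨⟨_, hG.comp e.symm.continuous⟩, fun t => ?_⟩
  have h2 : e.symm (Circle.exp (2 * Real.pi * t)) = ((t : ℝ) : AddCircle (1 : ℝ)) := by
    rw [Homeomorph.symm_apply_eq, AddCircle.homeomorphCircle_apply, AddCircle.toCircle_apply_mk,
      div_one]
  simp only [ContinuousMap.coe_mk, Function.comp_apply]
  rw [h2, hkey]

theorem exists_circle_exp_eq (u : Circle) :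
    ∃ t : unitInterval, Circle.exp (2 * Real.pi * t) = u := by
  let e := AddCircle.homeomorphCircle (T := (1 : ℝ)) one_ne_zero
  obtain ⟨t, ht⟩ := (AddCircle.equivIco (1 : ℝ) 0).symm.surjective (e.symm u)
  refine ⟨⟨t, t.2.1, by simpa using t.2.2.le⟩, ?_⟩
  have h1 : ((t : ℝ) : AddCircle (1 : ℝ)) = e.symm u := ht
  rw [Homeomorph.eq_symm_apply, AddCircle.homeomorphCircle_apply, AddCircle.toCircle_apply_mk,
    div_one] at h1
  exact h1

/-- The universal covering of the annulus, extended to the plane. -/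
def annulusCover : C(ℝ × ℝ, Circle × unitInterval) where
  toFun v := (Circle.exp v.1, Set.projIcc 0 1 zero_le_one v.2)
  continuous_toFun := (Circle.exp.continuous.comp continuous_fst).prodMk
    (continuous_projIcc.comp continuous_snd)

/-- A loop winding `n` times lifts through `L` to a path from a point to its translate by `γ ^ n`.
If its image is null-homotopic this path closes, so `γ ^ n = 1` and `n = 0`; the loop then lifts to
a closed loop in the plane and contracts. -/
theorem isIncompressible_of_lift {A : C(Circle × unitInterval, OrbitSpace Γ HypSpace)}
    {L : C(ℝ × ℝ, HypSpace)} (hL : ∀ v, OrbitSpace.proj Γ (L v) = A (annulusCover v)) {γ : Γ}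
    (hγ : ∀ v : ℝ × ℝ, L (v.1 + 2 * Real.pi, v.2) = γ • L v) (hord : ∀ n : ℤ, γ ^ n = 1 → n = 0) :
    IsIncompressible A := by
  have hzpow (n : ℤ) (v : ℝ × ℝ) : L (v.1 + n * (2 * Real.pi), v.2) = γ ^ n • L v := by
    induction n using Int.induction_on generalizing v with
    | zero => simp
    | succ n ih =>
      have := hγ (v.1 + n * (2 * Real.pi), v.2)
      have ih' := ih v
      simp only [Int.cast_natCast] at ih'
      rw [ih', smul_smul] at this
      rw [add_comm (n : ℤ) 1, zpow_add, zpow_one, ← this]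
      congr 2
      push_cast; ring
    | pred n ih =>
      have := hγ (v.1 + ((-n - 1 : ℤ) : ℝ) * (2 * Real.pi), v.2)
      have e : v.1 + ((-n - 1 : ℤ) : ℝ) * (2 * Real.pi) + 2 * Real.pi =
          v.1 + ((-n : ℤ) : ℝ) * (2 * Real.pi) := by push_cast; ring
      simp only [e] at this
      rw [ih v, ← inv_smul_eq_iff, smul_smul] at this
      rw [← this, sub_eq_add_neg, add_comm, zpow_add, zpow_neg_one]
  rintro ⟨u, s⟩
  obtain ⟨t₀, rfl⟩ := exists_circle_exp_eq u
  rw [injective_iff_map_eq_one]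
  intro c hc
  obtain ⟨l, hlc⟩ : ∃ l : Path (Circle.exp (2 * Real.pi * t₀), s)
      (Circle.exp (2 * Real.pi * t₀), s),
    Path.Homotopic.Quotient.mk l = c := Path.Homotopic.Quotient.mk_surjective c
  subst hlc
  have hl : (l.map A.continuous).Homotopic (Path.refl _) := Path.Homotopic.Quotient.eq.1 hc
  obtain ⟨θ, hθ, hθ0⟩ := Circle.isCoveringMap_exp.exists_path_lifts
    (⟨fun t => (l t).1, continuous_fst.comp l.continuous⟩ : C(unitInterval, Circle))
    (2 * Real.pi * t₀) (by simp)
  have hθ' (t : unitInterval) : Circle.exp (θ t) = (l t).1 := congrFun hθ t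
  let M : C(unitInterval, ℝ × ℝ) := ⟨fun t => (θ t, ((l t).2 : ℝ)),
    θ.continuous.prodMk (continuous_subtype_val.comp (continuous_snd.comp l.continuous))⟩
  have hM (t : unitInterval) : annulusCover (M t) = l t :=
    Prod.ext (hθ' t) (by simp [M, annulusCover])
  have h1 : L (M 1) = L (M 0) :=
    OrbitSpace.isCoveringMap_proj.apply_one_eq_of_homotopic_refl hl (L.comp M) fun t => by
      simp [hL, hM]
  obtain ⟨n, hn⟩ : ∃ n : ℤ, θ 1 = θ 0 + n * (2 * Real.pi) := by
    apply Circle.exp_eq_exp.1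
    rw [hθ', hθ', l.source, l.target]
  have hM0 : M 0 = (2 * Real.pi * t₀, (s : ℝ)) := by simp [M, hθ0]
  have h2 : M 1 = ((M 0).1 + n * (2 * Real.pi), (M 0).2) := by simp [M, hn]
  have h3 : γ ^ n • L (M 0) = (1 : Γ) • L (M 0) := by rw [← hzpow, ← h2, h1, one_smul]
  have h4 : n = 0 := hord n (IsCancelSMul.right_cancel _ _ _ h3)
  have h5 : M 1 = M 0 := by rw [h2, h4]; simp
  let m : Path (M 0) (M 0) := ⟨M, rfl, h5⟩
  have h6 : m.Homotopic (Path.refl _) := SimplyConnectedSpace.paths_homotopic _ _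
  have e0 : (Circle.exp (2 * Real.pi * t₀), s) = annulusCover (M 0) := by rw [hM, l.source]
  have h7 := (h6.map annulusCover).pathCast e0 e0
  refine Path.Homotopic.Quotient.eq.2 ?_
  convert h7 using 1
  · ext1; funext t
    exact (hM t).symm
  · ext1; funext t
    exact e0

end Lift

/-! ### Isometries preserving a horoball -/

namespace HypSpace

/-- The horosphere of height one, parametrized by the complex plane. -/
def ofComplex (w : ℂ) : HypSpace := ⟨w.re, w.im, 1, one_pos⟩

theorem ofComplex_mk {p : HypSpace} (hp : p.z = 1) : ofComplex ⟨p.x, p.y⟩ = p :=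
  HypSpace.ext rfl rfl hp.symm

theorem dist_ofComplex (v w : ℂ) :
    dist (ofComplex v) (ofComplex w) = 2 * Real.arsinh (dist v w / 2) := by
  rw [dist_eq, dist_toE, Complex.dist_eq_re_im]
  simp [ofComplex]

theorem continuous_ofComplex : Continuous ofComplex := by
  refine continuous_iff_continuousAt.2 fun v => tendsto_iff_dist_tendsto_zero.2 ?_
  simp only [dist_ofComplex]
  have h : Continuous fun w : ℂ => 2 * Real.arsinh (dist w v / 2) :=
    continuous_const.mul (Real.continuous_arsinh.comp (by fun_prop))
  simpa using h.tendsto v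

/-- Were `h p` at depth `d > 0`, the point `q` at distance `d` straight below `p` would still be
mapped into the horoball, although it lies outside. -/
theorem z_eq_one_of_image_eq (h : HypSpace ≃ᵢ HypSpace)
    (hh : h '' {p | 1 ≤ p.z} = {p | 1 ≤ p.z}) {p : HypSpace} (hp : p.z = 1) : (h p).z = 1 := by
  have h1 : 1 ≤ (h p).z := by
    have : h p ∈ h '' {p | 1 ≤ p.z} := ⟨p, hp.ge, rfl⟩
    rwa [hh] at this
  by_contra hne
  have h2 : 1 < (h p).z := lt_of_le_of_ne h1 (Ne.symm hne)
  have hd : 0 < Real.log (h p).z := Real.log_pos h2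
  let q : HypSpace := ⟨p.x, p.y, Real.exp (-Real.log (h p).z), Real.exp_pos _⟩
  have hpq : dist p q = Real.log (h p).z := by
    rw [dist_eq_abs_log_sub_log (p := p) (q := q) rfl rfl, hp]
    simp [q, abs_of_pos hd]
  have h3 := abs_log_sub_log_le_dist (h p) (h q)
  rw [h.dist_eq, hpq] at h3
  have h4 : 1 ≤ (h q).z := by
    rw [← Real.log_nonneg_iff (h q).z_pos]
    linarith [le_abs_self (Real.log (h p).z - Real.log (h q).z)]
  have h5 : h q ∈ h '' {p | 1 ≤ p.z} := by rw [hh]; exact h4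
  obtain ⟨q', hq', he⟩ := h5
  rw [h.injective he] at hq'
  have h6 : q.z < 1 := by
    simpa [q] using hd
  exact absurd hq' (not_le.2 h6)

end HypSpace

/-- An isometry of the plane is affine (Mazur–Ulam), so it fixes the average of a finite orbit. -/
theorem Isometry.exists_fixedPoint_of_iterate_eq {f : ℂ → ℂ} (hf : Isometry f) {n : ℕ} (hn : n ≠ 0)
    (h : ∀ w, f^[n] w = w) : ∃ c, f c = c := by
  obtain ⟨m, rfl⟩ := Nat.exists_eq_succ_of_ne_zero hn
  have hfg (w : ℂ) : f (f^[m] w) = w := by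
    rw [← Function.iterate_succ_apply' f, h]
  let F := (IsometryEquiv.mk' f _ hfg hf).toRealAffineIsometryEquiv
  have hF (w : ℂ) : F w = f w := rfl
  have hadd (w : ℂ) : f w = F.linearIsometryEquiv w + f 0 := by
    simpa [hF] using F.map_vadd 0 w
  have hsum : ∑ k ∈ Finset.range (m + 1), f^[k + 1] 0 = ∑ k ∈ Finset.range (m + 1), f^[k] 0 := by
    rw [Finset.sum_range_succ, Finset.sum_range_succ', h]
    simp
  refine ⟨((m + 1 : ℝ)⁻¹) • ∑ k ∈ Finset.range (m + 1), f^[k] 0, ?_⟩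
  rw [hadd, map_smul, map_sum]
  conv_rhs => rw [← hsum]
  simp only [Function.iterate_succ_apply']
  rw [Finset.sum_congr rfl fun k _ => hadd (f^[k] 0), Finset.sum_add_distrib, smul_add]
  congr 1
  have : (m + 1 : ℝ) ≠ 0 := by positivity
  rw [Finset.sum_const, Finset.card_range, ← Nat.cast_smul_eq_nsmul ℝ, smul_smul]
  push_cast
  rw [inv_mul_cancel₀ this, one_smul]

namespace ToroidalCusp

variable {Γ : Type*} [Group Γ] [MulAction Γ HypSpace] [IsIsometricSMul Γ HypSpace]

/-- The action of an element of `Γ` in the chart of a cusp. -/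
def chartAction (N : ToroidalCusp Γ) (γ : Γ) : HypSpace ≃ᵢ HypSpace :=
  (N.chart.trans (IsometryEquiv.constSMul γ)).trans N.chart.symm

theorem chart_chartAction (N : ToroidalCusp Γ) (γ : Γ) (p : HypSpace) :
    N.chart (N.chartAction γ p) = γ • N.chart p := by
  simp [chartAction]

theorem chartAction_z_eq_one (N : ToroidalCusp Γ) {γ : Γ} (hγ : γ • N.horoball = N.horoball)
    {p : HypSpace} (hp : p.z = 1) : (N.chartAction γ p).z = 1 := by
  refine HypSpace.z_eq_one_of_image_eq _ ?_ hp
  apply N.chart.injective.image_injective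
  rw [Set.image_image]
  simp only [chart_chartAction]
  rw [← Set.image_image (fun q => γ • q) N.chart]
  exact hγ

/-- The stabilizer of the horoball acts on the horosphere by Euclidean isometries. An element of
finite order would have a fixed point there, against freeness. -/
theorem eq_zero_of_zpow_eq_one [IsCancelSMul Γ HypSpace] (N : ToroidalCusp Γ) {γ : Γ}
    (hγ : γ • N.horoball = N.horoball) (h1 : γ ≠ 1) {n : ℤ} (hn : γ ^ n = 1) : n = 0 := by
  by_contra hn0
  let f : ℂ → ℂ := fun w =>
    ⟨(N.chartAction γ (HypSpace.ofComplex w)).x, (N.chartAction γ (HypSpace.ofComplex w)).y⟩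
  have hf (w : ℂ) : HypSpace.ofComplex (f w) = N.chartAction γ (HypSpace.ofComplex w) :=
    HypSpace.ofComplex_mk (N.chartAction_z_eq_one hγ rfl)
  have hiso : Isometry f := by
    refine Isometry.of_dist_eq fun v w => ?_
    have h := (N.chartAction γ).dist_eq (HypSpace.ofComplex v) (HypSpace.ofComplex w)
    rw [← hf, ← hf, HypSpace.dist_ofComplex, HypSpace.dist_ofComplex] at h
    have := Real.arsinh_injective (mul_left_cancel₀ two_ne_zero h)
    linarith
  have hinj : Function.Injective fun w => N.chart (HypSpace.ofComplex w) := by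
    refine N.chart.injective.comp fun v w h => Complex.ext ?_ ?_
    · exact congrArg HypSpace.x h
    · exact congrArg HypSpace.y h
  have hit (k : ℕ) (w : ℂ) :
      N.chart (HypSpace.ofComplex (f^[k] w)) = γ ^ k • N.chart (HypSpace.ofComplex w) := by
    induction k with
    | zero => simp
    | succ k ih =>
      rw [Function.iterate_succ_apply', hf, chart_chartAction, ih, smul_smul, pow_succ']
  obtain ⟨c, hc⟩ := hiso.exists_fixedPoint_of_iterate_eq (Int.natAbs_ne_zero.2 hn0) fun w =>
    hinj (by simp only [hit]; rw [pow_natAbs_eq_one.2 hn, one_smul])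
  have h2 : γ • N.chart (HypSpace.ofComplex c) = (1 : Γ) • N.chart (HypSpace.ofComplex c) := by
    rw [← chart_chartAction, ← hf, hc, one_smul]
  exact h1 (IsCancelSMul.right_cancel _ _ _ h2)

end ToroidalCusp

/-! ### Surfaces reaching deep into a cusp -/

namespace ToroidalCusp

variable {Γ : Type*} [Group Γ] [MulAction Γ HypSpace]

theorem iInf_qdist_le (N : ToroidalCusp Γ) {p : HypSpace} (hp : 1 ≤ p.z) :
    ⨅ t : N.Torus, OrbitSpace.qdist (OrbitSpace.proj Γ (N.chart p)) (N.torusMap t) ≤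
      ENNReal.ofReal (Real.log p.z) := by
  let q : HypSpace := ⟨p.x, p.y, 1, one_pos⟩
  refine (iInf_le _ (Quot.mk _ ⟨N.chart q, q, rfl, rfl⟩)).trans ?_
  unfold OrbitSpace.qdist
  refine iInf₂_le_of_le (N.chart p) rfl (iInf₂_le_of_le (N.chart q) rfl ?_)
  rw [N.chart.edist_eq, edist_dist, HypSpace.dist_eq_abs_log_sub_log (p := p) (q := q) rfl rfl]
  simp [q, abs_of_nonneg (Real.log_nonneg hp)]

theorem smul_horoball_eq {N : ToroidalCusp Γ} {γ : Γ} {p q : HypSpace} (hp : 1 < p.z)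
    (hq : 1 < q.z) (h : N.chart q = γ • N.chart p) : γ • N.horoball = N.horoball := by
  refine (N.precisely_invariant γ).resolve_right fun hd => ?_
  have hmem : N.chart q ∈ γ • (N.chart '' {p | 1 < p.z}) := by
    rw [h]
    exact Set.smul_mem_smul_set ⟨p, hp, rfl⟩
  exact Set.disjoint_left.1 hd hmem ⟨q, hq, rfl⟩

variable [IsIsometricSMul Γ HypSpace]
    [ProperlyDiscontinuousSMul Γ HypSpace] [IsCancelSMul Γ HypSpace]
    {Δ : Type*} [Group Δ] [MulAction Δ ℍ] [IsIsometricSMul Δ ℍ]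
    [ProperlyDiscontinuousSMul Δ ℍ] [IsCancelSMul Δ ℍ]

/-- An annulus that lifts to a strip joining a path to a translate of itself. -/
theorem exists_annulus {γ : Γ} (hord : ∀ n : ℤ, γ ^ n = 1 → n = 0)
    (sq : C(unitInterval × unitInterval, HypSpace)) (hsq : ∀ s, sq (1, s) = γ • sq (0, s)) :
    ∃ A : C(Circle × unitInterval, OrbitSpace Γ HypSpace), IsIncompressible A ∧
      ∀ t s : unitInterval,
        A (Circle.exp (2 * Real.pi * t), s) = OrbitSpace.proj Γ (sq (t, s)) := by
  have cov := OrbitSpace.isCoveringMap_proj (G := Γ) (X := HypSpace)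
  let P : C(HypSpace, OrbitSpace Γ HypSpace) := ⟨_, cov.continuous⟩
  obtain ⟨A', hA'⟩ := exists_circle_map (P.comp sq).curry (by
    ext s
    simp only [ContinuousMap.curry_apply, ContinuousMap.comp_apply, hsq]
    exact (OrbitSpace.proj_smul γ _).symm)
  have hA (t s : unitInterval) :
      A'.uncurry (Circle.exp (2 * Real.pi * t), s) = OrbitSpace.proj Γ (sq (t, s)) := by
    rw [ContinuousMap.uncurry_apply]
    simp only [Function.uncurry]
    rw [hA']
    rfl
  refine ⟨A'.uncurry, ?_, hA⟩
  obtain ⟨L, ⟨hL0, hL⟩, -⟩ := cov.existsUnique_continuousMap_lifts (A'.uncurry.comp annulusCover)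
    ((0 : ℝ), (0 : ℝ)) (sq (0, 0)) (by
      rw [ContinuousMap.comp_apply, ← hA]
      simp [annulusCover])
  have hL' (v : ℝ × ℝ) : OrbitSpace.proj Γ (L v) = A'.uncurry (annulusCover v) := congrFun hL v
  have key := OrbitSpace.eq_smul_of_proj_comp_eq (G := Γ) (Y := unitInterval × unitInterval)
    (a := sq) (b := fun v => L (2 * Real.pi * v.1, v.2)) sq.continuous (by fun_prop)
    (fun v => by rw [hL', ← hA]; simp [annulusCover]) (y₀ := (0, 0)) (g := 1) (by simp [hL0])
  have key' := OrbitSpace.eq_smul_of_proj_comp_eq (G := Γ) (Y := ℝ × ℝ)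
    (a := L) (b := fun v => L (v.1 + 2 * Real.pi, v.2)) L.continuous (by fun_prop)
    (fun v => by simp [hL', annulusCover, Circle.exp_add]) (y₀ := (0, 0)) (g := γ) (by
      have := key (1, 0)
      simp only [one_smul, hsq] at this
      simpa [hL0] using this)
  exact isIncompressible_of_lift hL' key' hord

/-- The strip has `Φ` of a path `x → δ x` as bottom, a path on the horosphere from a point to its
`γ`-image as top, and an arbitrary path and its `γ`-translate as sides. It closes up in the
quotient, and the annulus is incompressible since `γ` has infinite order. -/
theorem coannular_of_lift (N : ToroidalCusp Γ) {φ : C(OrbitSpace Δ ℍ, OrbitSpace Γ HypSpace)}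
    {Φ : C(ℍ, HypSpace)} (hΦ : ∀ y, OrbitSpace.proj Γ (Φ y) = φ (OrbitSpace.proj Δ y))
    {δ : Δ} {γ : Γ} (hδ : ∀ y, Φ (δ • y) = γ • Φ y) (hγ : γ • N.horoball = N.horoball)
    (h1 : γ ≠ 1) : N.Coannular φ := by
  have hcΔ : Continuous (OrbitSpace.proj Δ : ℍ → OrbitSpace Δ ℍ) :=
    OrbitSpace.isCoveringMap_proj.continuous
  let x := UpperHalfPlane.I
  let α : Path x (δ • x) := PathConnectedSpace.somePath x (δ • x)
  let q := N.chartAction γ (HypSpace.ofComplex 0)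
  have hq : HypSpace.ofComplex ⟨q.x, q.y⟩ = q :=
    HypSpace.ofComplex_mk (N.chartAction_z_eq_one hγ rfl)
  let σ : Path (0 : ℂ) ⟨q.x, q.y⟩ := PathConnectedSpace.somePath _ _
  let top : Path (N.chart (HypSpace.ofComplex 0)) (γ • N.chart (HypSpace.ofComplex 0)) :=
    (σ.map (N.chart.continuous.comp HypSpace.continuous_ofComplex)).cast rfl (by
      rw [Function.comp_apply, hq, chart_chartAction])
  let left : Path (Φ x) (N.chart (HypSpace.ofComplex 0)) := PathConnectedSpace.somePath _ _
  let right := left.map (continuous_const_smul γ)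
  obtain ⟨sq, hb, ht, hl, hr⟩ := HypSpace.exists_square
    ((α.map Φ.continuous).cast rfl (hδ x).symm) top left right
  obtain ⟨A, hA, hAsq⟩ := exists_annulus (fun n => N.eq_zero_of_zpow_eq_one hγ h1) sq
    fun s => by rw [hr, hl]; rfl
  obtain ⟨a, ha⟩ := exists_circle_map (⟨_, hcΔ.comp α.continuous⟩ : C(unitInterval, _)) (by
    simp [OrbitSpace.proj_smul])
  let τ : C(unitInterval, N.horosphere) :=
    ⟨fun t => ⟨N.chart (HypSpace.ofComplex (σ t)), _, rfl, rfl⟩,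
      (N.chart.continuous.comp (HypSpace.continuous_ofComplex.comp σ.continuous)).subtype_mk _⟩
  obtain ⟨b, hb'⟩ := exists_circle_map
    (⟨fun t => Quot.mk _ (τ t), continuous_quot_mk.comp τ.continuous⟩ :
      C(unitInterval, N.Torus)) (by
      refine Quot.sound ⟨γ, hγ, ?_⟩
      simp only [τ, ContinuousMap.coe_mk, σ.source, σ.target, hq]
      exact (N.chart_chartAction γ _).symm)
  refine ⟨A, a, b, hA, fun u => ?_, fun u => ?_⟩
  · obtain ⟨t, rfl⟩ := exists_circle_exp_eq u
    rw [hAsq, hb, ha]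
    exact hΦ (α t)
  · obtain ⟨t, rfl⟩ := exists_circle_exp_eq u
    rw [hAsq, ht, hb']
    rfl

/-! ### The depth of a surface -/

/-- The ball of radius `log p.z` about `x` is embedded: it maps into the open horoball, so an
overlap with a translate would yield a nontrivial stabilizing element and an annulus. -/
theorem cosh_log_le (N : ToroidalCusp Γ) {φ : C(OrbitSpace Δ ℍ, OrbitSpace Γ HypSpace)}
    (hφ : IsPleatedSurface φ) {g : ℝ} (hg : IsClosedSurfaceOfGenus (OrbitSpace Δ ℍ) g)
    (hinc : IsIncompressible φ) (hcoann : ¬ N.Coannular φ) {x : ℍ} {p : HypSpace} (hp : 1 ≤ p.z)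
    (hx : OrbitSpace.proj Γ (N.chart p) = φ (OrbitSpace.proj Δ x)) :
    Real.cosh (Real.log p.z) ≤ 2 * g := by
  obtain ⟨Φ, hΦx, hΦ⟩ := exists_lift_of_proj_eq φ hx
  refine hg.cosh_le x (Real.log_nonneg hp) fun δ hδ => ?_
  obtain ⟨γ, hγ⟩ := exists_lift_smul_eq hΦ δ
  have hball (u : ℍ) (hu : u ∈ Metric.ball x (Real.log p.z)) :
      ∃ q : HypSpace, 1 < q.z ∧ N.chart q = Φ u := by
    refine ⟨N.chart.symm (Φ u), ?_, N.chart.apply_symm_apply _⟩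
    have h1 := hφ.dist_lift_le hΦ x u
    have h2 := HypSpace.abs_log_sub_log_le_dist p (N.chart.symm (Φ u))
    rw [← N.chart.dist_eq, N.chart.apply_symm_apply, ← hΦx] at h2
    rw [← Real.log_pos_iff (HypSpace.z_pos _).le]
    rw [Metric.mem_ball'] at hu
    linarith [le_abs_self (Real.log p.z - Real.log (N.chart.symm (Φ u)).z)]
  refine Set.disjoint_left.2 fun v hv hv' => hcoann ?_
  obtain ⟨u, hu, rfl⟩ := hv
  obtain ⟨q, hq, hqu⟩ := hball u hu
  obtain ⟨q', hq', hqu'⟩ := hball _ hv'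
  refine N.coannular_of_lift hΦ hγ (smul_horoball_eq hq hq' ?_) fun h1 => hδ ?_
  · rw [hqu, hqu', ← hγ]
  · refine hinc.eq_one_of_lift_smul_eq hΦ (x := x) ?_
    rw [hγ, h1, one_smul]

theorem depth_le (N : ToroidalCusp Γ) {φ : C(OrbitSpace Δ ℍ, OrbitSpace Γ HypSpace)}
    (hφ : IsPleatedSurface φ) {g : ℝ} (hg : IsClosedSurfaceOfGenus (OrbitSpace Δ ℍ) g)
    (hinc : IsIncompressible φ) (hcoann : ¬ N.Coannular φ) :
    N.depth φ ≤ ENNReal.ofReal (Real.log (4 * g)) := by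
  refine iSup₂_le fun s hs => ?_
  obtain ⟨_, ⟨p, hp, rfl⟩, hps⟩ := hs
  obtain ⟨x, rfl⟩ := OrbitSpace.proj_surjective s
  have h := N.cosh_log_le hφ hg hinc hcoann hp hps
  rw [← hps]
  refine (N.iInf_qdist_le hp).trans (ENNReal.ofReal_le_ofReal ?_)
  refine Real.log_le_log p.z_pos ?_
  -- `cosh (log z) = (z + 1/z) / 2`, so `cosh (log z) ≤ 2g` yields `z < 4g`.
  rw [Real.cosh_log p.z_pos] at h
  have := inv_pos.2 p.z_pos
  linarith

end ToroidalCusp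

end

theorem theorem1p1
    {Γ : Type*} [Group Γ] [MulAction Γ HypSpace] [IsIsometricSMul Γ HypSpace]
    [ProperlyDiscontinuousSMul Γ HypSpace] [IsCancelSMul Γ HypSpace]
    {Δ : Type*} [Group Δ] [MulAction Δ UpperHalfPlane] [IsIsometricSMul Δ UpperHalfPlane]
    [ProperlyDiscontinuousSMul Δ UpperHalfPlane] [IsCancelSMul Δ UpperHalfPlane]
    (N : ToroidalCusp Γ)
    (φ : C(OrbitSpace Δ UpperHalfPlane, OrbitSpace Γ HypSpace))
    (hφ : IsPleatedSurface φ)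
    (g : ℝ) (hg : IsClosedSurfaceOfGenus (OrbitSpace Δ UpperHalfPlane) g)
    (hinc : IsIncompressible φ)
    (hcoann : ¬ N.Coannular φ) :
    N.depth φ < ENNReal.ofReal (Real.log (2 * g * Real.pi)) := by
  refine (N.depth_le hφ hg hinc hcoann).trans_lt ?_
  have hg' := hg.half_le
  -- Strictness comes from `4 < 2π`, so it survives the supremum. Since `g ≥ 1/2`, the logarithms
  -- are positive and `ENNReal.ofReal` does not truncate.
  have hlt : 4 * g < 2 * g * Real.pi := by nlinarith [Real.pi_gt_three]
  have hlog := Real.log_lt_log (by linarith) hlt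
  exact (ENNReal.ofReal_lt_ofReal_iff_of_nonneg (Real.log_nonneg (by linarith))).2 hlog
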